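/- Let $(P,d)$ be a nonempty finite metric space, whose points are called sites, and let $k\ge 2$. A schedule of a robot (of maximum speed $1$) is an infinite sequence of sites $p_0,p_1,\dots$ with arrival and departure times $0\le a_0$, $a_n\le b_n$, $a_{n+1}-b_n\ge d(p_n,p_{n+1})$, $a_n\to\infty$; the robot visits $p_n$ at every time $t\in[a_n,b_n]$. A patrol schedule consists of such a schedule for each of $k$ robots. The latency of a site $s$ is the supremum of the lengths of the time intervals $(a,b)$, $0\le a<b$, during which no robot visits $s$ (and $0$ if there is no such interval), and the latency of a patrol schedule is the maximum latency of a site. Let $L$ be the optimal latency, that is, the infimum of the latencies of all patrol schedules for $k$ robots. A patrol schedule is a cyclic solution if $P$ is partitioned into nonempty sets $P_1,\dots,P_\ell$, $\ell\le k$, and the robots are distributed over these sets, with $k_i\ge 1$ robots for $P_i$ and $\sum_{i=1}^{\ell} k_i=k$, such that the $k_i$ robots of $P_i$ move at unit speed and in the same direction along one shortest closed tour $T_i$ through all the sites of $P_i$, each one at distance $\|T_i\|/k_i$ along the tour from the next, where $\|T_i\|$ is the length of $T_i$ (if $P_i$ is a single site, they stay there). Then there is a cyclic solution with latency at most $2\left(1-\frac1k\right)L$.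 -/

import Mathlib

open scoped ENNReal

namespace Patrol

/-- The schedule of one robot of maximum speed one: an infinite sequence of sites to visit, together
with the times at which the robot arrives at and leaves the `n`-th site of the sequence. The robot
stays at `site n` during `[arrive n, depart n]` and travels to the next site in between.
It may start anywhere (so it may reach its first site after time `0`). -/
structure RobotSchedule (P : Type*) [MetricSpace P] where
  site : ℕ → P
  arrive : ℕ → ℝ
  depart : ℕ → ℝ
  arrive_nonneg : 0 ≤ arrive 0
  arrive_le_depart : ∀ n, arrive n ≤ depart n
  speed_limit : ∀ n, dist (site n) (site (n + 1)) ≤ arrive (n + 1) - depart n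
  tendsto_arrive : Filter.Tendsto arrive Filter.atTop Filter.atTop

/-- The robot is at site `p` at time `t`. -/
def RobotSchedule.VisitsAt {P : Type*} [MetricSpace P] (f : RobotSchedule P) (p : P) (t : ℝ) :
    Prop :=
  ∃ n, f.site n = p ∧ f.arrive n ≤ t ∧ t ≤ f.depart n

/-- A patrol schedule for `k` robots. -/
abbrev Schedule (P : Type*) [MetricSpace P] (k : ℕ) : Type _ := Fin k → RobotSchedule P

/-- The latency of a site: the supremum of the lengths of the time intervals during which
no robot visits it. -/
noncomputable def Schedule.siteLatency {P : Type*} [MetricSpace P] {k : ℕ} (σ : Schedule P k)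
    (p : P) : ℝ≥0∞ :=
  ⨆ (a : ℝ) (b : ℝ) (_ : 0 ≤ a) (_ : a < b)
    (_ : ∀ t, a < t → t < b → ∀ r, ¬ (σ r).VisitsAt p t), ENNReal.ofReal (b - a)

/-- The latency of a schedule: the maximum latency of a site. -/
noncomputable def Schedule.latency {P : Type*} [MetricSpace P] {k : ℕ} (σ : Schedule P k) :
    ℝ≥0∞ :=
  ⨆ p : P, σ.siteLatency p

/-- The optimal latency of the `k`-robot patrol-scheduling problem on `P`. -/
noncomputable def optimalLatency (P : Type*) [MetricSpace P] (k : ℕ) : ℝ≥0∞ :=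
  ⨅ σ : Schedule P k, σ.latency

/-- The length of the closed tour `c 0, c 1, …, c m, c 0`; addition in `Fin (m + 1)` is cyclic. -/
noncomputable def tourLength {P : Type*} [MetricSpace P] {m : ℕ} (c : Fin (m + 1) → P) : ℝ :=
  ∑ i, dist (c i) (c (i + 1))

/-- The distance along the closed tour `c` from its first site `c 0` to its site `c i`. -/
noncomputable def arcLength {P : Type*} [MetricSpace P] {m : ℕ} (c : Fin (m + 1) → P)
    (i : Fin (m + 1)) : ℝ :=
  ∑ j ∈ Finset.Iio i, dist (c j) (c (j + 1))

/-- `c` is a tour of the set `S`: it lists every site of `S` exactly once. -/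
def IsTour {P : Type*} {m : ℕ} (S : Set P) (c : Fin (m + 1) → P) : Prop :=
  Function.Injective c ∧ Set.range c = S

/-- `c` is a travelling salesman tour of `S`, that is, a shortest tour of `S`.
(Two tours of `S` have the same number of sites.) -/
def IsTSPTour {P : Type*} [MetricSpace P] {m : ℕ} (S : Set P) (c : Fin (m + 1) → P) : Prop :=
  IsTour S c ∧ ∀ c' : Fin (m + 1) → P, IsTour S c' → tourLength c ≤ tourLength c'

/-- Going a distance `x` along the closed tour `c` from `c 0`, and around it as often as necessary
(backwards if `x < 0`), ends at the site `p`. A tour of length `0` consists of a single site,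
at which one then stays. -/
def TourAt {P : Type*} [MetricSpace P] {m : ℕ} (c : Fin (m + 1) → P) (x : ℝ) (p : P) : Prop :=
  (tourLength c = 0 ∧ p ∈ Set.range c) ∨
    ∃ (i : Fin (m + 1)) (z : ℤ), c i = p ∧ x = arcLength c i + z * tourLength c

/-- The combinatorial data of a cyclic solution: a partition of the sites into `numGroups`
nonempty groups, a travelling salesman tour of each group, and a distribution of all `k` robots
over the groups, with `numRobots i ≥ 1` robots for the `i`-th group (so `numGroups ≤ k`). -/
structure CyclicPlan (P : Type*) [MetricSpace P] (k : ℕ) where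
  numGroups : ℕ
  group : Fin numGroups → Set P
  group_nonempty : ∀ i, (group i).Nonempty
  group_disjoint : ∀ i j, i ≠ j → Disjoint (group i) (group j)
  group_cover : ∀ p, ∃ i, p ∈ group i
  lastIndex : Fin numGroups → ℕ
  tour : ∀ i, Fin (lastIndex i + 1) → P
  isTSPTour : ∀ i, IsTSPTour (group i) (tour i)
  numRobots : Fin numGroups → ℕ
  numRobots_pos : ∀ i, 0 < numRobots i
  robot : (Σ i, Fin (numRobots i)) ≃ Fin k

/-- A schedule is cyclic if, for some plan, the robots of each group move at unit speed along the
tour of the group, all in the same direction, evenly spaced: the `j`-th of the `kᵢ` robots on a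
tour of length `ℓ` has a head start of `j ℓ / kᵢ`. Here `phase i` is the position of the `0`-th
robot of the `i`-th group at time `0`. -/
def Schedule.IsCyclic {P : Type*} [MetricSpace P] {k : ℕ} (σ : Schedule P k) : Prop :=
  ∃ (C : CyclicPlan P k) (phase : Fin C.numGroups → ℝ),
    ∀ (i : Fin C.numGroups) (j : Fin (C.numRobots i)) (t : ℝ), 0 ≤ t → ∀ p : P,
      (σ (C.robot ⟨i, j⟩)).VisitsAt p t ↔
        TourAt (C.tour i) (phase i + t + j * (tourLength (C.tour i) / C.numRobots i)) p

end Patrol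

/-! ### Walks of bounded length in a metric space -/

namespace Patrol

/-! Take a schedule of latency below `L`, use `L` as the unit of time, and choose a time `0` after
its beginning. Assign to each robot `z` a time window such that the windows cover all sites. At the
first stage every window starts at `0` and ends with a first visit. The site where it ends was
visited at most one unit earlier, hence not after time `0`, by a robot `par z`. So the trajectory of
`z` through its window, continued along that of `par z` up to its starting point, is a walk of
length at most `1` between the starting points of the two robots. This gives a functional graph on
the robots.

A component with `m` robots has a closed walk of length `2m` that uses each link back and forth.
Going round a cycle of at least two links only once saves at least `2`, and `2m - 2 ≤ (2 - 2/k) m`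
because `m ≤ k`. A self-link saves only `1`, which suffices when `m ≤ k/2`. So the only obstacle is
one component with more than `k/2` robots and a self-linked root `r`.

For this component the windows of the leaves are started later (`raise`). The walk of a link then
has length at most `1` plus the difference of the two starting times. These differences telescope,
since a robot with a positive starting time has at most one link to it. A leaf that starts at `1/2`
yields the missing saving. If a leaf `j` cannot start later, then some site is covered only by `j`
at its very start; the latency bound gives a robot `i` that visits this site within the next unit.
Depending on `i`, its trajectory either provides an additional link that closes a cycle and saves
enough, or lets `j` be served by a loop of its own (`close`, the set `Q`), or allows the window of
`i` to be extended and `i` to be linked to `j` (`retarget`). Each change increases a bounded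
measure, so the process ends with a grouping (`IsRooted.exists_progress`). The most delicate case is
`hasGrouping_of_earlier`.

Shortcutting the closed walks gives tours of the groups, and evenly spaced robots turn the length
per robot into latency. There are finitely many groupings, so one of them also serves the infimum of
the latencies. -/

/-- There is a walk from `a` to `b` of length at most `ℓ` through all the points of `S`:
the points of `S` can be labelled by the distances at which the walk passes them. -/
def Walk {E : Type*} [MetricSpace E] (a b : E) (S : Set E) (ℓ : ℝ) : Prop :=
  dist a b ≤ ℓ ∧ ∃ t : E → ℝ, (∀ s ∈ S, dist a s ≤ t s ∧ dist s b ≤ ℓ - t s) ∧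
    ∀ s ∈ S, ∀ s' ∈ S, dist s s' ≤ |t s - t s'|

namespace Walk

variable {E : Type*} [MetricSpace E] {a b c : E} {S S' : Set E} {ℓ ℓ' : ℝ}

theorem mono (h : Walk a b S ℓ) (hS : S' ⊆ S) (hℓ : ℓ ≤ ℓ') : Walk a b S' ℓ' := by
  obtain ⟨h0, t, h1, h2⟩ := h
  refine ⟨h0.trans hℓ, t, fun s hs => ⟨(h1 s (hS hs)).1, ?_⟩, fun s hs s' hs' =>
    h2 s (hS hs) s' (hS hs')⟩
  linarith [(h1 s (hS hs)).2]

theorem refl (a : E) : Walk a a {a} 0 := by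
  refine ⟨by simp, fun _ => 0, ?_, ?_⟩ <;> simp

theorem reverse (h : Walk a b S ℓ) : Walk b a S ℓ := by
  obtain ⟨h0, t, h1, h2⟩ := h
  refine ⟨by rwa [dist_comm], fun s => ℓ - t s, fun s hs => ⟨?_, ?_⟩, fun s hs s' hs' => ?_⟩
  · rw [dist_comm]; exact (h1 s hs).2
  · rw [dist_comm]; linarith [(h1 s hs).1]
  · have := h2 s hs s' hs'
    rwa [show ℓ - t s - (ℓ - t s') = -(t s - t s') by ring, abs_neg]

/-- The labels of the second walk are shifted by `ℓ`, and a point on both walks keeps its first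
label. Distances between points of different walks are bounded through `b`. -/
theorem append (h : Walk a b S ℓ) (h' : Walk b c S' ℓ') : Walk a c (S ∪ S') (ℓ + ℓ') := by
  classical
  obtain ⟨h0, t, h1, h2⟩ := h
  obtain ⟨h0', t', h1', h2'⟩ := h'
  have key : ∀ s ∈ S, ∀ s' ∈ S', dist s s' ≤ ℓ + t' s' - t s := fun s hs s' hs' => by
    have := dist_triangle s b s'
    linarith [(h1 s hs).2, (h1' s' hs').1]
  refine ⟨by linarith [dist_triangle a b c], fun s => if s ∈ S then t s else ℓ + t' s, ?_, ?_⟩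
  · intro s hs
    by_cases hsS : s ∈ S
    · simp only [hsS, if_true]
      refine ⟨(h1 s hsS).1, ?_⟩
      linarith [dist_triangle s b c, (h1 s hsS).2]
    · have hs' : s ∈ S' := hs.resolve_left hsS
      simp only [hsS, if_false]
      refine ⟨?_, by linarith [(h1' s hs').2]⟩
      linarith [dist_triangle a b s, (h1' s hs').1]
  · intro s hs s' hs'
    by_cases hsS : s ∈ S <;> by_cases hsS' : s' ∈ S <;> simp only [hsS, hsS', if_true, if_false]
    · exact h2 s hsS s' hsS'
    · rw [abs_sub_comm]
      exact (key s hsS s' (hs'.resolve_left hsS')).trans (le_abs_self _)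
    · rw [dist_comm]
      exact (key s' hsS' s (hs.resolve_left hsS)).trans (le_abs_self _)
    · have := h2' s (hs.resolve_left hsS) s' (hs'.resolve_left hsS')
      rwa [show ℓ + t' s - (ℓ + t' s') = t' s - t' s' by ring]

/-- The label of `c` separates the points passed before it from those passed after it. -/
theorem split (h : Walk a b S ℓ) (hc : c ∈ S) : ∃ S₁ S₂ ℓ₁ ℓ₂, Walk a c S₁ ℓ₁ ∧ Walk c b S₂ ℓ₂ ∧
    S = S₁ ∪ S₂ ∧ ℓ₁ + ℓ₂ = ℓ := by
  obtain ⟨h0, t, h1, h2⟩ := h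
  refine ⟨{s ∈ S | t s ≤ t c}, {s ∈ S | t c ≤ t s}, t c, ℓ - t c, ⟨(h1 c hc).1, t, ?_, ?_⟩,
    ⟨(h1 c hc).2, fun s => t s - t c, ?_, ?_⟩, ?_, by ring⟩
  · rintro s ⟨hs, hsc⟩
    refine ⟨(h1 s hs).1, ?_⟩
    have := h2 s hs c hc
    rwa [abs_sub_comm, abs_of_nonneg (by linarith)] at this
  · exact fun s hs s' hs' => h2 s hs.1 s' hs'.1
  · rintro s ⟨hs, hsc⟩
    refine ⟨?_, by linarith [(h1 s hs).2]⟩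
    have := h2 c hc s hs
    rwa [abs_sub_comm, abs_of_nonneg (by linarith)] at this
  · intro s hs s' hs'
    rw [show t s - t c - (t s' - t c) = t s - t s' by ring]
    exact h2 s hs.1 s' hs'.1
  · ext s
    simp only [Set.mem_union, Set.mem_ofPred_eq, ← and_or_left]
    exact ⟨fun h => ⟨h, le_total _ _⟩, fun h => h.1⟩

theorem insert_left (h : Walk a b S ℓ) : Walk a b (insert a S) ℓ := by
  have := (refl a).append h
  rwa [Set.singleton_union, zero_add] at this

theorem insert_right (h : Walk a b S ℓ) : Walk a b (insert b S) ℓ :=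
  h.reverse.insert_left.reverse

/-- A closed walk may be started at any of its points. -/
theorem rotate (h : Walk a a S ℓ) (hc : c ∈ S) : Walk c c S ℓ := by
  obtain ⟨S₁, S₂, ℓ₁, ℓ₂, h₁, h₂, rfl, rfl⟩ := h.split hc
  exact (h₂.append h₁).mono (by rw [Set.union_comm]) (by linarith)

/-- Insert a closed walk into another one at a common point. -/
theorem merge (h : Walk a a S ℓ) (h' : Walk b b S' ℓ') (hc : c ∈ S) (hc' : c ∈ S') :
    Walk a a (S ∪ S') (ℓ + ℓ') := by
  obtain ⟨S₁, S₂, ℓ₁, ℓ₂, h₁, h₂, rfl, rfl⟩ := h.split hc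
  refine ((h₁.append (h'.rotate hc')).append h₂).mono ?_ (by linarith)
  rintro s ((hs | hs) | hs)
  exacts [.inl (.inl hs), .inr hs, .inl (.inr hs)]

/-- Walk back and forth. -/
theorem double (h : Walk a b S ℓ) : Walk a a (insert a (insert b S)) (2 * ℓ) :=
  (h.insert_right.insert_left.append h.reverse).mono Set.subset_union_left (by linarith)

/-- A piece of a trajectory of speed at most one. -/
theorem of_lipschitz {x : ℝ → E} (hx : ∀ s t, dist (x s) (x t) ≤ |s - t|) {s t : ℝ} (hst : s ≤ t) :
    Walk (x s) (x t) (x '' Set.Icc s t) (t - s) := by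
  classical
  have hch : ∀ p ∈ x '' Set.Icc s t, ∃ v, (s ≤ v ∧ v ≤ t) ∧ x v = p := fun p hp => hp
  choose! v hv hvx using hch
  refine ⟨(hx s t).trans (by rw [abs_sub_comm, abs_of_nonneg (by linarith)]),
    fun p => v p - s, fun p hp => ⟨?_, ?_⟩, fun p hp q hq => ?_⟩
  · have := hx s (v p)
    rwa [hvx p hp, abs_sub_comm, abs_of_nonneg (by linarith [(hv p hp).1])] at this
  · have := hx (v p) t
    rw [hvx p hp, abs_sub_comm, abs_of_nonneg (by linarith [(hv p hp).2])] at this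
    linarith
  · have := hx (v p) (v q)
    rw [hvx p hp, hvx q hq] at this
    rwa [show v p - s - (v q - s) = v p - v q by ring]

end Walk

end Patrol

/-! ### Closed walks in functional graphs of linked robots -/

namespace Patrol

/-- Robots `z` with base points `base z` at times `time z`, and windows `window z` to cover. Each robot
is linked to another one by a walk through its window, of length at most `1` plus the difference
of the times, and a base point at a positive time has at most one link to it. -/
structure Network (R E : Type*) [MetricSpace E] where
  next : R → R
  time : R → ℝ
  base : R → E
  window : R → Set E
  edge : ∀ z, Walk (base z) (base (next z)) (window z) (1 + time (next z) - time z)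
  time_nonneg : ∀ z, 0 ≤ time z
  next_inj : ∀ a b, next a = next b → 0 < time (next a) → a = b

/-- Two points are connected in the functional graph of `f`. -/
def Conn {R : Type*} (f : R → R) (a b : R) : Prop := ∃ n m, f^[n] a = f^[m] b

namespace Conn

variable {R : Type*} {f : R → R} {a b c : R}

theorem refl (a : R) : Conn f a a := ⟨0, 0, rfl⟩

theorem symm (h : Conn f a b) : Conn f b a := by
  obtain ⟨n, m, h⟩ := h
  exact ⟨m, n, h.symm⟩

theorem trans (h : Conn f a b) (h' : Conn f b c) : Conn f a c := by
  obtain ⟨n, m, h⟩ := h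
  obtain ⟨n', m', h'⟩ := h'
  refine ⟨n' + n, m + m', ?_⟩
  rw [Function.iterate_add_apply, h, ← Function.iterate_add_apply, add_comm,
    Function.iterate_add_apply, h', ← Function.iterate_add_apply]

theorem apply (a : R) : Conn f a (f a) := ⟨1, 0, rfl⟩

theorem iterate (a : R) (n : ℕ) : Conn f a (f^[n] a) := ⟨n, 0, rfl⟩

theorem of_fixed {o z : R} (ho : f o = o) (h : Conn f z o) : ∃ n, f^[n] z = o := by
  obtain ⟨n, m, h⟩ := h
  exact ⟨n, by rw [h, Function.iterate_fixed ho]⟩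

end Conn

theorem exists_minimalPeriod_pos {R : Type*} [Finite R] (f : R → R) (a : R) :
    ∃ i, 0 < Function.minimalPeriod f (f^[i] a) := by
  obtain ⟨i, j, hij, h⟩ := Finite.exists_ne_map_eq_of_infinite fun n => f^[n] a
  wlog hlt : i < j generalizing i j
  · exact this j i hij.symm h.symm (by omega)
  refine ⟨i, Function.IsPeriodicPt.minimalPeriod_pos (n := j - i) (by omega) ?_⟩
  change f^[j - i] (f^[i] a) = f^[i] a
  rw [← Function.iterate_add_apply, Nat.sub_add_cancel hlt.le]
  exact h.symm

/-- A point on the way to a fixed point is not periodic. -/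
theorem iterate_ne_of_reach {R : Type*} {f : R → R} {r z : R} (hr : f r = r)
    (hz : ∃ n, f^[n] z = r) (hzr : z ≠ r) {d : ℕ} (hd : 0 < d) : f^[d] z ≠ z := by
  intro h
  obtain ⟨n, hn⟩ := hz
  apply hzr
  have h1 : f^[d * n] z = z := by
    rw [Function.iterate_mul]; exact Function.iterate_fixed h n
  have h2 : d * n = (d * n - n) + n := by
    have : n ≤ d * n := Nat.le_mul_of_pos_left n hd
    omega
  rw [h2, Function.iterate_add_apply, hn, Function.iterate_fixed hr] at h1
  exact h1.symm

theorem reach_iterate {R : Type*} {f : R → R} {r z : R} (hr : f r = r)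
    (hz : ∃ n, f^[n] z = r) (m : ℕ) : ∃ n, f^[n] (f^[m] z) = r := by
  obtain ⟨n, hn⟩ := hz
  exact ⟨n, by rw [← Function.iterate_add_apply, add_comm, Function.iterate_add_apply, hn,
    Function.iterate_fixed hr]⟩

/-- A repetition before `r` is reached would be a periodic point other than `r` that leads to `r`.
-/
theorem injOn_iterate_of_reach {R : Type*} {f : R → R} {r z : R} (hr : f r = r)
    (hz : ∃ n, f^[n] z = r) {N : ℕ} (hN : ∀ i < N, f^[i] z ≠ r) :
    Set.InjOn (fun i => f^[i] z) (Finset.range N) := by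
  have key : ∀ i j, i < j → i < N → f^[i] z ≠ f^[j] z := by
    intro i j hij hi h
    refine iterate_ne_of_reach hr (reach_iterate hr hz i) (hN i hi) (Nat.sub_pos_of_lt hij) ?_
    rw [← Function.iterate_add_apply, Nat.sub_add_cancel hij.le, h]
  intro i hi j hj h
  simp only [Finset.coe_range, Set.mem_Iio] at hi hj
  rcases lt_trichotomy i j with h1 | h1 | h1
  · exact absurd h (key i j h1 hi)
  · exact h1
  · exact absurd h.symm (key j i h1 hj)

/-- Closed walks between linked base points combine to a closed walk of a connected set. -/
theorem exists_walk_of_connected {R E : Type*} [MetricSpace E] [DecidableEq R] {f : R → R}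
    {y : R → E} {F : R → Set E} {cost : R → ℝ} {K : Finset R} (hK : ∀ z ∈ K, f z ∈ K)
    (hconn : ∀ z ∈ K, ∀ z' ∈ K, Conn f z z') {a₀ : R} (ha₀ : a₀ ∈ K)
    {y₀ : E} (A : Finset R) (S₀ : Set E) (ℓ₀ : ℝ) (hy : y a₀ ∈ S₀)
    (hA : ∀ z ∈ A, F z ⊆ S₀ ∧ y z ∈ S₀ ∧ y (f z) ∈ S₀) (hw : Walk y₀ y₀ S₀ ℓ₀)
    (hcost : ∀ z ∈ K \ A, Walk (y z) (y z) (insert (y z) (insert (y (f z)) (F z))) (cost z)) :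
    ∃ S, S₀ ⊆ S ∧ (∀ z ∈ K, F z ⊆ S ∧ y z ∈ S) ∧
      Walk y₀ y₀ S (ℓ₀ + ∑ z ∈ K \ A, cost z) := by
  induction hn : (K \ A).card generalizing A S₀ ℓ₀ with
  | zero =>
    have hKA : K \ A = ∅ := Finset.card_eq_zero.1 hn
    refine ⟨S₀, subset_rfl, fun z hz => ?_, by simpa [hKA] using hw⟩
    have := hA z (Finset.sdiff_eq_empty_iff_subset.1 hKA hz)
    exact ⟨this.1, this.2.1⟩
  | succ n ih =>
    -- Some unused link touches the walk. Otherwise all iterates of `a₀` have base points in `S₀`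
    -- and all iterates of an unused `z₀` have base points outside, although the two orbits meet.
    have hex : ∃ z ∈ K \ A, y z ∈ S₀ ∨ y (f z) ∈ S₀ := by
      by_contra! hno
      obtain ⟨z₀, hz₀⟩ := Finset.card_pos.1 (by rw [hn]; exact Nat.succ_pos n)
      have hKn : ∀ z ∈ K, ∀ n, f^[n] z ∈ K := fun z hz n => by
        induction n with
        | zero => exact hz
        | succ n ih => rw [Function.iterate_succ_apply']; exact hK _ ih
      have h1 : ∀ n, y (f^[n] a₀) ∈ S₀ := fun n => by
        induction n with
        | zero => exact hy
        | succ n ih =>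
          rw [Function.iterate_succ_apply']
          by_cases h : f^[n] a₀ ∈ A
          · exact (hA _ h).2.2
          · exact absurd ih (hno _ (Finset.mem_sdiff.2 ⟨hKn _ ha₀ n, h⟩)).1
      have h2 : ∀ n, y (f^[n] z₀) ∉ S₀ := fun n => by
        induction n with
        | zero => exact (hno _ hz₀).1
        | succ n ih =>
          rw [Function.iterate_succ_apply']
          by_cases h : f^[n] z₀ ∈ A
          · exact absurd (hA _ h).2.1 ih
          · exact (hno _ (Finset.mem_sdiff.2 ⟨hKn _ (Finset.mem_sdiff.1 hz₀).1 n, h⟩)).2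
      obtain ⟨n, m, h⟩ := hconn a₀ ha₀ z₀ (Finset.mem_sdiff.1 hz₀).1
      exact h2 m (h ▸ h1 n)
    obtain ⟨z, hz, hzy⟩ := hex
    have hw' : Walk y₀ y₀ (S₀ ∪ insert (y z) (insert (y (f z)) (F z))) (ℓ₀ + cost z) := by
      rcases hzy with h | h
      · exact hw.merge (hcost z hz) h (by simp)
      · exact hw.merge (hcost z hz) h (by simp)
    have hsd : K \ insert z A = (K \ A).erase z := by
      ext w; simp only [Finset.mem_sdiff, Finset.mem_insert, Finset.mem_erase]; tauto
    obtain ⟨S, hS, hS', hS''⟩ := ih (insert z A) _ _ (.inl hy) (fun w hw => by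
      rcases Finset.mem_insert.1 hw with rfl | hw
      · exact ⟨fun s hs => .inr (by simp [hs]), .inr (by simp), .inr (by simp)⟩
      · obtain ⟨h1, h2, h3⟩ := hA w hw
        exact ⟨fun s hs => .inl (h1 hs), .inl h2, .inl h3⟩) hw'
      (fun w hw => hcost w (by rw [hsd] at hw; exact Finset.mem_of_mem_erase hw))
      (by rw [hsd, Finset.card_erase_of_mem hz, hn]; rfl)
    refine ⟨S, Set.subset_union_left.trans hS, hS', hS''.mono subset_rfl (le_of_eq ?_)⟩
    rw [hsd, ← Finset.add_sum_erase _ _ hz]; ring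

namespace Network

variable {R E : Type*} [MetricSpace E] (N : Network R E)

/-- Follow `n` links. -/
theorem walk_iterate (z : R) (n : ℕ) :
    Walk (N.base z) (N.base (N.next^[n] z))
      {s | (∃ i < n, s ∈ N.window (N.next^[i] z)) ∨ ∃ i ≤ n, s = N.base (N.next^[i] z)}
      (n + N.time (N.next^[n] z) - N.time z) := by
  induction n with
  | zero =>
    refine (Walk.refl _).mono ?_ (by simp)
    rintro s (⟨i, hi, -⟩ | ⟨i, hi, rfl⟩)
    · omega
    · obtain rfl : i = 0 := by omega
      simp
  | succ n ih =>
    have h := ih.append (N.edge (N.next^[n] z)).insert_right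
    rw [← Function.iterate_succ_apply' N.next n z] at h
    refine h.mono ?_ (by push_cast; linarith)
    rintro s (⟨i, hi, hs⟩ | ⟨i, hi, rfl⟩)
    · rcases Nat.lt_succ_iff_lt_or_eq.1 hi with hi | rfl
      · exact .inl (.inl ⟨i, hi, hs⟩)
      · exact .inr (.inr hs)
    · rcases Nat.le_succ_iff.1 hi with hi | rfl
      · exact .inl (.inr ⟨i, hi, rfl⟩)
      · exact .inr (.inl rfl)

theorem walk_double (z : R) :
    Walk (N.base z) (N.base z)
      (insert (N.base z) (insert (N.base (N.next z)) (N.window z)))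
      (2 * (1 + N.time (N.next z) - N.time z)) := (N.edge z).double

/-- The total time of the links out of `S`. -/
theorem sum_time_next_le [DecidableEq R] {S S' : Finset R} (h : ∀ z ∈ S, N.next z ∈ S') :
    ∑ z ∈ S, N.time (N.next z) ≤ ∑ z ∈ S', N.time z := by
  classical
  -- Links to time zero contribute nothing; on the remaining ones `next` is injective, so no time is
  -- counted twice.
  have h1 : ∑ z ∈ S, N.time (N.next z) = ∑ z ∈ S with 0 < N.time (N.next z), N.time (N.next z) := by
    symm
    apply Finset.sum_filter_of_ne
    exact fun z _ hz => lt_of_le_of_ne (N.time_nonneg _) hz.symm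
  rw [h1, ← Finset.sum_image (f := N.time) (g := N.next)]
  · apply Finset.sum_le_sum_of_subset_of_nonneg
    · intro w hw
      obtain ⟨z, hz, rfl⟩ := Finset.mem_image.1 hw
      exact h z (Finset.mem_filter.1 hz).1
    · exact fun _ _ _ => N.time_nonneg _
  · intro a ha b _ hab
    exact N.next_inj a b hab (Finset.mem_filter.1 ha).2

/-- A component with a cycle of at least two links. -/
theorem exists_walk_of_cycle [DecidableEq R] {K : Finset R} (hK : ∀ z ∈ K, N.next z ∈ K)
    (hconn : ∀ z ∈ K, ∀ z' ∈ K, Conn N.next z z') {a : R} (ha : a ∈ K)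
    (hper : 2 ≤ Function.minimalPeriod N.next a) :
    ∃ S, N.base a ∈ S ∧ (∀ z ∈ K, N.window z ⊆ S ∧ N.base z ∈ S) ∧
      Walk (N.base a) (N.base a) S (2 * K.card - 2) := by
  set c := Function.minimalPeriod N.next a with hc
  have hca : N.next^[c] a = a := Function.iterate_minimalPeriod
  have hKn : ∀ n, N.next^[n] a ∈ K := fun n => by
    induction n with
    | zero => exact ha
    | succ n ih => rw [Function.iterate_succ_apply']; exact hK _ ih
  have hw := N.walk_iterate a c
  rw [hca] at hw
  set A : Finset R := (Finset.range c).image (fun i => N.next^[i] a) with hAdef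
  have hinj : Set.InjOn (fun i => N.next^[i] a) (Finset.range c) := by
    intro i hi j hj h
    simp only [Finset.coe_range, Set.mem_Iio] at hi hj
    exact Function.iterate_injOn_Iio_minimalPeriod hi hj h
  have hAK : A ⊆ K := fun z hz => by
    obtain ⟨i, -, rfl⟩ := Finset.mem_image.1 hz
    exact hKn i
  have hAc : A.card = c := by rw [hAdef, Finset.card_image_of_injOn hinj, Finset.card_range]
  obtain ⟨S, hS, hS', hS''⟩ := exists_walk_of_connected (y := N.base) (F := N.window)
    (cost := fun z => 2 * (1 + N.time (N.next z) - N.time z)) hK hconn ha A _ _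
    (Or.inr ⟨0, Nat.zero_le _, rfl⟩) (fun z hz => by
      obtain ⟨i, hi, rfl⟩ := Finset.mem_image.1 hz
      have hi := Finset.mem_range.1 hi
      refine ⟨fun s hs => .inl ⟨i, hi, hs⟩, .inr ⟨i, hi.le, rfl⟩, .inr ⟨i + 1, hi, ?_⟩⟩
      rw [Function.iterate_succ_apply']) hw (fun z _ => N.walk_double z)
  refine ⟨S, hS (.inr ⟨0, Nat.zero_le _, rfl⟩), hS', hS''.mono subset_rfl ?_⟩
  -- The time differences cancel around the cycle. Its `c` links are paid once and the others twice,
  -- so the total is at most `2 * K.card - c`, where `c ≥ 2`.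
  have h1 : ∑ z ∈ A, (N.time (N.next z) - N.time z) = 0 := by
    rw [hAdef, Finset.sum_image hinj]
    have := Finset.sum_range_sub (fun i => N.time (N.next^[i] a)) c
    simp only [Function.iterate_succ_apply'] at this
    rw [this, hca]; simp
  have h2 : ∑ z ∈ K, (N.time (N.next z) - N.time z) ≤ 0 := by
    rw [Finset.sum_sub_distrib]; linarith [N.sum_time_next_le hK]
  have h3 := Finset.sum_sdiff (f := fun z => N.time (N.next z) - N.time z) hAK
  have h4 : ∑ z ∈ K \ A, 2 * (1 + N.time (N.next z) - N.time z) =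
      2 * ((K \ A).card + ∑ z ∈ K \ A, (N.time (N.next z) - N.time z)) := by
    rw [← Finset.mul_sum, Finset.cast_card, ← Finset.sum_add_distrib]
    congr 1; apply Finset.sum_congr rfl; intros; ring
  have h5 : ((K \ A).card : ℝ) = K.card - c := by
    rw [Finset.card_sdiff_of_subset hAK, Nat.cast_sub (Finset.card_le_card hAK), hAc]
  have h6 : (2 : ℝ) ≤ c := by exact_mod_cast hper
  rw [h4, h5]
  linarith

/-- A component with a fixed point. -/
theorem exists_walk_of_fixed [DecidableEq R] {K : Finset R} (hK : ∀ z ∈ K, N.next z ∈ K)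
    (hconn : ∀ z ∈ K, ∀ z' ∈ K, Conn N.next z z') {a : R} (ha : a ∈ K) (hfix : N.next a = a) :
    ∃ S, (∀ z ∈ K, N.window z ⊆ S ∧ N.base z ∈ S) ∧
      Walk (N.base a) (N.base a) S (2 * K.card - 1) := by
  have hw := (N.edge a).insert_left
  rw [hfix] at hw
  obtain ⟨S, hS, hS', hS''⟩ := exists_walk_of_connected (y := N.base) (F := N.window)
    (cost := fun z => 2 * (1 + N.time (N.next z) - N.time z)) hK hconn ha {a} _ _
    (Set.mem_insert _ _) (fun z hz => by
      obtain rfl := Finset.mem_singleton.1 hz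
      exact ⟨Set.subset_insert _ _, Set.mem_insert _ _, by rw [hfix]; exact Set.mem_insert _ _⟩)
    hw (fun z _ => N.walk_double z)
  refine ⟨S, hS', hS''.mono subset_rfl ?_⟩
  have h2 : ∑ z ∈ K, (N.time (N.next z) - N.time z) ≤ 0 := by
    rw [Finset.sum_sub_distrib]; linarith [N.sum_time_next_le hK]
  have h3 := Finset.sum_sdiff (f := fun z => N.time (N.next z) - N.time z)
    (Finset.singleton_subset_iff.2 ha)
  rw [Finset.sum_singleton, hfix] at h3
  have h4 : ∑ z ∈ K \ {a}, 2 * (1 + N.time (N.next z) - N.time z) =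
      2 * ((K \ {a}).card + ∑ z ∈ K \ {a}, (N.time (N.next z) - N.time z)) := by
    rw [← Finset.mul_sum, Finset.cast_card, ← Finset.sum_add_distrib]
    congr 1; apply Finset.sum_congr rfl; intros; ring
  have h5 : ((K \ {a}).card : ℝ) = K.card - 1 := by
    rw [Finset.card_sdiff_of_subset (Finset.singleton_subset_iff.2 ha), Nat.cast_sub
      (Finset.card_le_card (Finset.singleton_subset_iff.2 ha))]
    simp
  rw [h4, h5]
  linarith

/-- The robots that lead to the fixed point `r`, with a walk from the base point of a leaf `g` to
the base point of `q` as an additional link. -/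
theorem exists_walk_of_link [DecidableEq R] {r g q : R} {K : Finset R}
    (hKr : ∀ z, z ∈ K ↔ ∃ n, N.next^[n] z = r) (hr : N.next r = r) (hTr : N.time r = 0)
    (hg : g ∈ K) (hleaf : ∀ z, N.next z ≠ g) (hq : q ∈ K) {S : Set E} {ℓ : ℝ}
    (hlink : Walk (N.base g) (N.base q) S ℓ) {F : Set E} {c : ℝ}
    (hloop : Walk (N.base r) (N.base r) F c) :
    ∃ S' ℓ', S ⊆ S' ∧ F ⊆ S' ∧ (∀ z ∈ K, N.base z ∈ S' ∧ (z ≠ r → N.window z ⊆ S')) ∧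
      Walk (N.base g) (N.base g) S' ℓ' ∧
      ((∃ n : ℕ, N.next^[n] g = q ∧
          ℓ' ≤ ℓ + c + 2 * (K.card - 1) - n - N.time q - N.time g) ∨
        ((¬ ∃ n, N.next^[n] g = q) ∧
          ℓ' ≤ ℓ + c + 2 * (K.card - 1) - 2 + N.time q - N.time g)) := by
  classical
  have hgr : g ≠ r := fun h => hleaf r (by rw [hr, h])
  have hrK : r ∈ K := (hKr r).2 ⟨0, rfl⟩
  have hKn : ∀ z ∈ K, ∀ n, N.next^[n] z ∈ K := fun z hz n =>
    (hKr _).2 (reach_iterate hr ((hKr z).1 hz) n)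
  have hK : ∀ z ∈ K, N.next z ∈ K := fun z hz => hKn z hz 1
  have hconn : ∀ z ∈ K, ∀ z' ∈ K, Conn N.next z z' := fun z hz z' hz' => by
    obtain ⟨n, hn⟩ := (hKr z).1 hz
    obtain ⟨m, hm⟩ := (hKr z').1 hz'
    exact ⟨n, m, hn.trans hm.symm⟩
  -- the meeting point of the ways from `g` and from `q`
  have hex : ∃ n m, N.next^[n] g = N.next^[m] q := hconn g hg q hq
  set n₁ := Nat.find hex with hn₁
  have hex' : ∃ m, N.next^[n₁] g = N.next^[m] q := Nat.find_spec hex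
  set n₂ := Nat.find hex' with hn₂
  have hmeet : N.next^[n₁] g = N.next^[n₂] q := Nat.find_spec hex'
  have hmin₁ : ∀ i < n₁, ∀ m, N.next^[i] g ≠ N.next^[m] q := fun i hi m h =>
    Nat.find_min hex hi ⟨m, h⟩
  have hmin₂ : ∀ m < n₂, N.next^[n₁] g ≠ N.next^[m] q := fun m hm => Nat.find_min hex' hm
  obtain ⟨dq, hdq⟩ := (hKr q).1 hq
  have hne₁ : ∀ i < n₁, N.next^[i] g ≠ r := fun i hi h => hmin₁ i hi dq (h.trans hdq.symm)
  have hne₂ : ∀ i < n₂, N.next^[i] q ≠ r := fun i hi h => by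
    refine hmin₂ i hi ?_
    rw [hmeet, h, show n₂ = (n₂ - i) + i by omega, Function.iterate_add_apply, h,
      Function.iterate_fixed hr]
  have hinj₁ := injOn_iterate_of_reach hr ((hKr g).1 hg) hne₁
  have hinj₂ := injOn_iterate_of_reach hr ((hKr q).1 hq) hne₂
  set A₁ : Finset R := (Finset.range n₁).image (fun i => N.next^[i] g) with hA₁
  set A₂ : Finset R := (Finset.range n₂).image (fun i => N.next^[i] q) with hA₂
  have hdisj : Disjoint A₁ A₂ := by
    rw [Finset.disjoint_left]
    intro z h1 h2
    obtain ⟨i, hi, rfl⟩ := Finset.mem_image.1 h1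
    obtain ⟨j, -, hj⟩ := Finset.mem_image.1 h2
    exact hmin₁ i (Finset.mem_range.1 hi) j hj.symm
  have hrA : r ∉ A₁ ∪ A₂ := by
    intro h
    rcases Finset.mem_union.1 h with h | h
    · obtain ⟨i, hi, h⟩ := Finset.mem_image.1 h
      exact hne₁ i (Finset.mem_range.1 hi) h
    · obtain ⟨i, hi, h⟩ := Finset.mem_image.1 h
      exact hne₂ i (Finset.mem_range.1 hi) h
  -- The closed walk takes the new link from `g` to `q`, goes up from `q` to the meeting point, and
  -- returns down to `g`. All links on it are paid once instead of twice.
  have hw := (hlink.append (N.walk_iterate q n₂)).append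
    ((congrArg N.base hmeet) ▸ (N.walk_iterate g n₁)).reverse
  -- The self-link of the root is replaced by the given loop, so that it may be dropped when the new
  -- link already covers the window of `r`.
  set F' : R → Set E := fun z => if z = r then F else N.window z with hF'
  set cost : R → ℝ := fun z => if z = r then c else 2 * (1 + N.time (N.next z) - N.time z)
    with hcostdef
  obtain ⟨S', hS, hS', hS''⟩ := exists_walk_of_connected (y := N.base) (F := F')
    (cost := cost) hK hconn hg (A₁ ∪ A₂) _ _
    (Or.inr (Or.inr ⟨0, Nat.zero_le _, rfl⟩)) (fun z hz => by
      have hzr : z ≠ r := fun h => hrA (h ▸ hz)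
      simp only [hF', hzr, if_false]
      rcases Finset.mem_union.1 hz with hz | hz
      · obtain ⟨i, hi, rfl⟩ := Finset.mem_image.1 hz
        have hi := Finset.mem_range.1 hi
        refine ⟨fun s hs => .inr (.inl ⟨i, hi, hs⟩), .inr (.inr ⟨i, hi.le, rfl⟩),
          .inr (.inr ⟨i + 1, hi, ?_⟩)⟩
        rw [Function.iterate_succ_apply']
      · obtain ⟨i, hi, rfl⟩ := Finset.mem_image.1 hz
        have hi := Finset.mem_range.1 hi
        refine ⟨fun s hs => .inl (.inr (.inl ⟨i, hi, hs⟩)), .inl (.inr (.inr ⟨i, hi.le, rfl⟩)),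
          .inl (.inr (.inr ⟨i + 1, hi, ?_⟩))⟩
        rw [Function.iterate_succ_apply']) hw (fun z _ => by
      by_cases hzr : z = r
      · subst hzr
        simp only [hF', hcostdef, if_true, hr]
        exact hloop.insert_left.insert_left
      · simp only [hF', hcostdef, hzr, if_false]
        exact N.walk_double z)
  refine ⟨S', _, fun s hs => hS (.inl (.inl hs)), ?_, fun z hz => ⟨(hS' z hz).2, fun hzr => ?_⟩,
    hS'', ?_⟩
  · have := (hS' r hrK).1
    simpa only [hF', if_true] using this
  · have := (hS' z hz).1
    simpa only [hF', hzr, if_false] using this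
  -- the length
  set d : R → ℝ := fun z => N.time (N.next z) - N.time z with hd
  have hA₁K : A₁ ⊆ K.erase r := fun z hz => by
    refine Finset.mem_erase.2 ⟨fun h => hrA (Finset.mem_union_left _ (h ▸ hz)), ?_⟩
    obtain ⟨i, -, rfl⟩ := Finset.mem_image.1 hz
    exact hKn g hg i
  have hA₂K : A₂ ⊆ K.erase r := fun z hz => by
    refine Finset.mem_erase.2 ⟨fun h => hrA (Finset.mem_union_right _ (h ▸ hz)), ?_⟩
    obtain ⟨i, -, rfl⟩ := Finset.mem_image.1 hz
    exact hKn q hq i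
  have hAK : A₁ ∪ A₂ ⊆ K.erase r := Finset.union_subset hA₁K hA₂K
  have hsum : ∑ z ∈ K \ (A₁ ∪ A₂), cost z = c + ∑ z ∈ K.erase r \ (A₁ ∪ A₂), 2 * (1 + d z) := by
    have hmem : r ∈ K \ (A₁ ∪ A₂) := Finset.mem_sdiff.2 ⟨hrK, hrA⟩
    rw [← Finset.add_sum_erase _ _ hmem, ← Finset.erase_sdiff_comm]
    congr 1
    · simp [hcostdef]
    · apply Finset.sum_congr rfl
      intro z hz
      have hzr : z ≠ r := Finset.ne_of_mem_erase (Finset.mem_sdiff.1 hz).1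
      simp only [hcostdef, hzr, if_false, hd]; ring
  have hd₁ : ∑ z ∈ A₁, d z = N.time (N.next^[n₁] g) - N.time g := by
    rw [hA₁, Finset.sum_image hinj₁]
    have := Finset.sum_range_sub (fun i => N.time (N.next^[i] g)) n₁
    simp only [Function.iterate_succ_apply'] at this
    simpa [hd] using this
  have hd₂ : ∑ z ∈ A₂, d z = N.time (N.next^[n₂] q) - N.time q := by
    rw [hA₂, Finset.sum_image hinj₂]
    have := Finset.sum_range_sub (fun i => N.time (N.next^[i] q)) n₂
    simp only [Function.iterate_succ_apply'] at this
    simpa [hd] using this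
  -- No link ends at the leaf `g`, so its time is subtracted without being added back. This is the
  -- gain from starting a leaf late.
  have hdK : ∑ z ∈ K.erase r, d z ≤ - N.time g := by
    have h1 := N.sum_time_next_le (S := K.erase r) (S' := K.erase g) (fun z hz =>
      Finset.mem_erase.2 ⟨hleaf z, hK z (Finset.mem_of_mem_erase hz)⟩)
    have h2 := Finset.add_sum_erase K N.time hrK
    have h3 := Finset.add_sum_erase K N.time hg
    rw [hd, Finset.sum_sub_distrib]
    linarith
  have hsd := Finset.sum_sdiff (f := d) hAK
  rw [Finset.sum_union hdisj] at hsd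
  have hcard : ((K.erase r \ (A₁ ∪ A₂)).card : ℝ) = K.card - 1 - (n₁ + n₂) := by
    rw [Finset.card_sdiff_of_subset hAK, Nat.cast_sub (Finset.card_le_card hAK),
      Finset.card_union_of_disjoint hdisj, Finset.card_erase_of_mem hrK, hA₁, hA₂,
      Finset.card_image_of_injOn hinj₁, Finset.card_image_of_injOn hinj₂,
      Nat.cast_sub (Finset.card_pos.2 ⟨r, hrK⟩)]
    simp
  have hsum' : ∑ z ∈ K.erase r \ (A₁ ∪ A₂), 2 * (1 + d z) =
      2 * ((K.erase r \ (A₁ ∪ A₂)).card + ∑ z ∈ K.erase r \ (A₁ ∪ A₂), d z) := by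
    rw [← Finset.mul_sum, Finset.cast_card, ← Finset.sum_add_distrib]
  rw [hsum, hsum', hcard, hmeet]
  rw [hmeet] at hd₁
  have hlca := N.time_nonneg (N.next^[n₂] q)
  rcases Nat.eq_zero_or_pos n₂ with h0 | hpos
  · left
    refine ⟨n₁, by rw [hmeet, h0]; rfl, ?_⟩
    rw [h0] at hd₁ hd₂ ⊢
    simp only [Function.iterate_zero, id_eq, Nat.cast_zero] at hd₁ hd₂ ⊢
    linarith
  · right
    -- If `g` were the meeting point, it would have a predecessor on the way from `q`. Hence both
    -- ways have at least one link, which saves `2`.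
    have hn1 : 1 ≤ n₁ := by
      by_contra hlt
      have h0 : n₁ = 0 := by omega
      rw [h0, show n₂ = (n₂ - 1) + 1 by omega, Function.iterate_succ_apply'] at hmeet
      exact hleaf _ hmeet.symm
    have h1 : (1 : ℝ) ≤ n₁ := by exact_mod_cast hn1
    have h2 : (1 : ℝ) ≤ n₂ := by exact_mod_cast hpos
    refine ⟨?_, by linarith⟩
    rintro ⟨n, hn⟩
    rcases lt_or_ge n n₁ with hlt | hge
    · exact hmin₁ n hlt 0 hn
    · -- `q` lies beyond the meeting point, so it would be periodic
      have h3 : N.next^[n - n₁ + n₂] q = q := by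
        rw [Function.iterate_add_apply, ← hmeet, ← Function.iterate_add_apply,
          Nat.sub_add_cancel hge, hn]
      have hqr : q ≠ r := hne₂ 0 hpos
      exact iterate_ne_of_reach hr ((hKr q).1 hq) hqr (by omega) h3

end Network

end Patrol

/-! ### Configurations of time windows and the groupings they give -/

namespace Patrol

/-- Trajectories of robots of maximum speed one in a metric space that contains the sites, with
finitely many visits that leave gaps of length at most one around time `0`. -/
structure PatrolData (R P E : Type*) [MetricSpace E] where
  pos : R → ℝ → E
  dist_pos_le : ∀ z s t, dist (pos z s) (pos z t) ≤ |s - t|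
  point : P → E
  visits : Set (R × P × ℝ)
  finite_visits : visits.Finite
  pos_eq : ∀ {z p t}, (z, p, t) ∈ visits → pos z t = point p
  forward : ∀ p t, 0 ≤ t → t ≤ 1 / 2 → ∃ z w, (z, p, w) ∈ visits ∧ t < w ∧ w ≤ t + 1
  backward : ∀ p t, 0 < t → t ≤ 1 → ∃ z w, (z, p, w) ∈ visits ∧ t - 1 ≤ w ∧ w < t

/-- The robots can be divided into groups, and the sites among the groups, such that each group
has a closed walk through its sites of length at most `2 - 2 / k` times the number of its robots. -/
def PatrolData.HasGrouping {R P E : Type*} [MetricSpace E] [Fintype R] [DecidableEq R]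
    (D : PatrolData R P E) : Prop :=
  ∃ (group : R → R) (robotOf : P → R), ∀ a, ∃ y,
    Walk y y (D.point '' {p | group (robotOf p) = group a})
      ((2 - 2 / Fintype.card R) * (Finset.univ.filter fun z => group z = group a).card)

/-- The link of a robot: itself if it is in `Q`, and its parent otherwise. -/
def linkOf {R : Type*} [DecidableEq R] (Q : Finset R) (par : R → R) (z : R) : R :=
  if z ∈ Q then z else par z

/-- Each robot `z` has a time window `[start z, finish z]`, and these windows cover all the sites.
The site of `z` at the end of its window is visited by its parent at the time `meet z`.
The robots in `Q` have a short closed walk through their window. -/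
structure Config {R P E : Type*} [MetricSpace E] [DecidableEq R] (D : PatrolData R P E) where
  start : R → ℝ
  finish : R → ℝ
  meet : R → ℝ
  par : R → R
  Q : Finset R
  start_nonneg : ∀ z, 0 ≤ start z
  start_le_half : ∀ z, start z ≤ 1 / 2
  start_le_finish : ∀ z, start z ≤ finish z
  meet_le : ∀ z, meet z ≤ start (par z)
  finish_le : ∀ z, finish z ≤ meet z + 1
  pos_meet : ∀ z, D.pos (par z) (meet z) = D.pos z (finish z)
  covers : ∀ p, ∃ z t, (z, p, t) ∈ D.visits ∧ start z ≤ t ∧ t ≤ finish z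
  loop : ∀ q ∈ Q, Walk (D.pos q (start q)) (D.pos q (start q))
    (D.pos q '' Set.Icc (start q) (finish q)) 1
  eq_of_linkOf_mem : ∀ q ∈ Q, ∀ z, linkOf Q par z = q → z = q
  linkOf_inj : ∀ a b, linkOf Q par a = linkOf Q par b → 0 < start (linkOf Q par a) → a = b

/-- The points that lead to `o` in the functional graph of `f`. -/
noncomputable def reach {R : Type*} [Fintype R] (f : R → R) (o : R) : Finset R :=
  open Classical in Finset.univ.filter fun z => ∃ n, f^[n] z = o

theorem mem_reach {R : Type*} [Fintype R] {f : R → R} {o z : R} :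
    z ∈ reach f o ↔ ∃ n, f^[n] z = o := by
  simp [reach]

namespace Config

variable {R P E : Type*} [MetricSpace E] [DecidableEq R] {D : PatrolData R P E}

abbrev next (c : Config D) : R → R := linkOf c.Q c.par

theorem next_of_mem (c : Config D) {z : R} (h : z ∈ c.Q) : c.next z = z := by
  simp [next, linkOf, h]

theorem next_of_notMem (c : Config D) {z : R} (h : z ∉ c.Q) : c.next z = c.par z := by
  simp [next, linkOf, h]

/-- The walk of a robot from an earlier time through its window to the base point of its parent. -/
theorem walk_par (c : Config D) (z : R) {w : ℝ} (hw : w ≤ c.start z) :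
    Walk (D.pos z w) (D.pos (c.par z) (c.start (c.par z)))
      (D.pos z '' Set.Icc (c.start z) (c.finish z)) (1 + c.start (c.par z) - w) := by
  have h1 := Walk.of_lipschitz (D.dist_pos_le z) (hw.trans (c.start_le_finish z))
  rw [← c.pos_meet z] at h1
  have h2 := h1.append (Walk.of_lipschitz (D.dist_pos_le (c.par z)) (c.meet_le z))
  refine h2.mono ?_ (by linarith [c.finish_le z])
  exact (Set.image_mono (Set.Icc_subset_Icc_left hw)).trans Set.subset_union_left

def network (c : Config D) : Network R E where
  next := c.next
  time := c.start
  base z := D.pos z (c.start z)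
  window z := D.pos z '' Set.Icc (c.start z) (c.finish z)
  edge z := by
    by_cases h : z ∈ c.Q
    · rw [c.next_of_mem h]
      exact (c.loop z h).mono subset_rfl (by linarith)
    · rw [c.next_of_notMem h]
      exact c.walk_par z le_rfl
  time_nonneg := c.start_nonneg
  next_inj := c.linkOf_inj

/-- The walk of a robot through its window to a later visit. -/
theorem walk_later (c : Config D) {g i : R} {w : ℝ} (hw : c.finish i < w)
    (hpos : D.pos i w = D.pos g (c.start g)) :
    Walk (c.network.base g) (c.network.base i) (c.network.window i) (w - c.start i) := by
  have h1 := Walk.of_lipschitz (D.dist_pos_le i) ((c.start_le_finish i).trans hw.le)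
  rw [hpos] at h1
  exact (h1.mono (Set.image_mono (Set.Icc_subset_Icc_right hw.le)) le_rfl).reverse

variable [Fintype R]

theorem reach_of_mem (c : Config D) {q : R} (hq : q ∈ c.Q) : reach c.next q = {q} := by
  ext z
  rw [mem_reach, Finset.mem_singleton]
  constructor
  · rintro ⟨n, hn⟩
    induction n with
    | zero => exact hn
    | succ n ih =>
      rw [Function.iterate_succ_apply'] at hn
      exact ih (c.eq_of_linkOf_mem q hq _ hn)
  · rintro rfl
    exact ⟨0, rfl⟩

/-- The components give a grouping if those that are not merged into `M` are small or have a
cycle. -/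
theorem hasGrouping (c : Config D) (hk : 2 ≤ Fintype.card R) (M : Finset R)
    (hM : ∀ z, c.next z ∈ M ↔ z ∈ M)
    (hMw : M.Nonempty → ∃ y S, (∀ z ∈ M, c.network.window z ⊆ S) ∧ Walk y y S (2 * M.card - 2))
    (hsmall : ∀ o, c.next o = o → o ∉ M → o ∉ c.Q →
      2 * (reach c.next o).card ≤ Fintype.card R) :
    D.HasGrouping := by
  classical
  have hMn : ∀ n z, c.next^[n] z ∈ M ↔ z ∈ M := fun n => by
    induction n with
    | zero => simp
    | succ n ih => intro z; rw [Function.iterate_succ_apply', hM, ih]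
  have hMc : ∀ {z a}, Conn c.next z a → (z ∈ M ↔ a ∈ M) := by
    rintro z a ⟨n, m, h⟩
    rw [← hMn n z, h, hMn]
  let s : Setoid R :=
    { r := fun z a => (z ∈ M ∧ a ∈ M) ∨ Conn c.next z a
      iseqv :=
        { refl := fun a => .inr (Conn.refl a)
          symm := fun h => h.imp And.symm Conn.symm
          trans := by
            rintro x y z (⟨h1, h2⟩ | h1) (⟨h3, h4⟩ | h3)
            · exact .inl ⟨h1, h4⟩
            · exact .inl ⟨h1, (hMc h3).1 h2⟩
            · exact .inl ⟨(hMc h1).2 h3, h4⟩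
            · exact .inr (h1.trans h3) } }
  choose rob tm hvis hst hsp using c.covers
  have hgrp : ∀ z a, (Quotient.mk s z).out = (Quotient.mk s a).out ↔
      (z ∈ M ∧ a ∈ M) ∨ Conn c.next z a := fun z a => by
    rw [Quotient.out_inj]; exact Quotient.eq (r := s)
  have hkpos : (0 : ℝ) < Fintype.card R := by exact_mod_cast (by omega : 0 < Fintype.card R)
  refine ⟨fun z => (Quotient.mk s z).out, rob, fun a => ?_⟩
  simp only [hgrp]
  set K : Finset R := Finset.univ.filter fun z => (z ∈ M ∧ a ∈ M) ∨ Conn c.next z a with hKdef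
  have hKk : (K.card : ℝ) ≤ Fintype.card R := by exact_mod_cast K.card_le_univ
  have hpts : ∀ S : Set E, (∀ z ∈ K, c.network.window z ⊆ S) →
      D.point '' {p | (rob p ∈ M ∧ a ∈ M) ∨ Conn c.next (rob p) a} ⊆ S := by
    rintro S hS _ ⟨p, hp, rfl⟩
    refine hS (rob p) (Finset.mem_filter.2 ⟨Finset.mem_univ _, hp⟩) ?_
    exact ⟨tm p, ⟨hst p, hsp p⟩, D.pos_eq (hvis p)⟩
  -- The factor of the theorem originates here: a saving of `2` always suffices, a saving of `1`
  -- only for components with at most half of the robots.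
  have hb1 : 2 * (K.card : ℝ) - 2 ≤ (2 - 2 / Fintype.card R) * K.card := by
    have : 2 / (Fintype.card R : ℝ) * K.card ≤ 2 := by
      rw [div_mul_eq_mul_div, div_le_iff₀ hkpos]; linarith
    linarith
  have hb2 : 2 * K.card ≤ Fintype.card R →
      2 * (K.card : ℝ) - 1 ≤ (2 - 2 / Fintype.card R) * K.card := fun h => by
    have h' : 2 * (K.card : ℝ) ≤ Fintype.card R := by exact_mod_cast h
    have : 2 / (Fintype.card R : ℝ) * K.card ≤ 1 := by
      rw [div_mul_eq_mul_div, div_le_iff₀ hkpos]; linarith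
    linarith
  by_cases haM : a ∈ M
  · have hKM : K = M := by
      ext z
      simp only [hKdef, Finset.mem_filter, Finset.mem_univ, true_and, haM, and_true]
      exact ⟨fun h => h.elim id fun h => (hMc h).2 haM, .inl⟩
    obtain ⟨y, S, hS, hw⟩ := hMw ⟨a, haM⟩
    rw [hKM] at hpts hb1 ⊢
    exact ⟨y, hw.mono (hpts S hS) hb1⟩
  · have hKmem : ∀ z, z ∈ K ↔ Conn c.next z a := fun z => by simp [hKdef, haM]
    have hK : ∀ z ∈ K, c.next z ∈ K := fun z hz =>
      (hKmem _).2 ((Conn.apply z).symm.trans ((hKmem z).1 hz))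
    have hconn : ∀ z ∈ K, ∀ z' ∈ K, Conn c.next z z' := fun z hz z' hz' =>
      ((hKmem z).1 hz).trans ((hKmem z').1 hz').symm
    obtain ⟨i, hpos⟩ := exists_minimalPeriod_pos c.next a
    set b := c.next^[i] a with hb
    have hbK : b ∈ K := (hKmem b).2 (Conn.iterate a i).symm
    rcases Nat.lt_or_ge 1 (Function.minimalPeriod c.next b) with h2 | h1
    · obtain ⟨S, -, hS, hw⟩ := c.network.exists_walk_of_cycle hK hconn hbK h2
      exact ⟨_, hw.mono (hpts S fun z hz => (hS z hz).1) hb1⟩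
    · have hfix : c.next b = b := Function.minimalPeriod_eq_one_iff_isFixedPt.1 (by omega)
      obtain ⟨S, hS, hw⟩ := c.network.exists_walk_of_fixed hK hconn hbK hfix
      have hKr : K = reach c.next b := by
        ext z
        rw [mem_reach]
        refine ⟨fun hz => Conn.of_fixed hfix (hconn z hz b hbK), ?_⟩
        rintro ⟨n, hn⟩
        exact (hKmem z).2 (((Conn.iterate z n).trans (by rw [hn]; exact Conn.refl b)).trans
          ((hKmem b).1 hbK))
      refine ⟨_, hw.mono (hpts S fun z hz => (hS z hz).1) (hb2 ?_)⟩
      -- A robot in `Q` is a component by itself, and `1 ≤ k / 2`.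
      by_cases hbQ : b ∈ c.Q
      · rw [hKr, c.reach_of_mem hbQ, Finset.card_singleton]; omega
      · rw [hKr]
        exact hsmall b hfix (fun hbM => haM ((hMn i a).1 hbM)) hbQ

end Config

end Patrol

/-! ### Rooted configurations and the savings from an additional link -/

namespace Patrol

namespace Config

variable {R P E : Type*} [MetricSpace E] [DecidableEq R] {D : PatrolData R P E} [Fintype R]

/-- `o` is linked to itself, but it is neither the root `r` nor in `Q`. -/
def IsIdle (c : Config D) (r o : R) : Prop := c.next o = o ∧ o ≠ r ∧ o ∉ c.Q

/-- The root `r` is linked to itself, and the other components with a self-link are small and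
unchanged. The parents of the robots in `Q` avoid these components. -/
structure IsRooted (c : Config D) (r : R) : Prop where
  par_root : c.par r = r
  start_root : c.start r = 0
  root_notMem : r ∉ c.Q
  small : ∀ o, c.IsIdle r o → 2 * (reach c.next o).card ≤ Fintype.card R
  start_eq_zero : ∀ o, c.IsIdle r o → ∀ z ∈ reach c.next o, c.start z = 0
  -- Parents of robots in `Q` are not used by `next`, but `exists_chain` follows them. This field
  -- and the next one make it end outside `Q` and outside the idle components.
  par_notMem : ∀ o, c.IsIdle r o → ∀ q ∈ c.Q, c.par q ∉ reach c.next o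
  rank : ∃ rk : R → ℕ, ∀ q ∈ c.Q, c.par q ∈ c.Q → rk (c.par q) < rk q

namespace IsRooted

variable {c : Config D} {r : R}

theorem next_root (h : c.IsRooted r) : c.next r = r := by
  rw [c.next_of_notMem h.root_notMem, h.par_root]

theorem root_mem (_ : c.IsRooted r) : r ∈ reach c.next r := mem_reach.2 ⟨0, rfl⟩

theorem next_mem_iff (h : c.IsRooted r) (z : R) :
    c.next z ∈ reach c.next r ↔ z ∈ reach c.next r := by
  rw [mem_reach, mem_reach]
  constructor
  · rintro ⟨n, hn⟩
    exact ⟨n + 1, hn⟩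
  · exact fun hz => reach_iterate h.next_root hz 1

theorem notMem_reach (h : c.IsRooted r) {q : R} (hq : q ∈ c.Q) : q ∉ reach c.next r := by
  intro hqr
  obtain ⟨n, hn⟩ := mem_reach.1 hqr
  rw [Function.iterate_fixed (c.next_of_mem hq)] at hn
  exact h.root_notMem (hn ▸ hq)

theorem hasGrouping_of_walk (h : c.IsRooted r) (hk : 2 ≤ Fintype.card R) (M : Finset R)
    (hM : ∀ z, c.next z ∈ M ↔ z ∈ M) (hr : r ∈ M) {y : E} {S : Set E}
    (hS : ∀ z ∈ M, c.network.window z ⊆ S) (hw : Walk y y S (2 * M.card - 2)) :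
    D.HasGrouping :=
  c.hasGrouping hk M hM (fun _ => ⟨y, S, hS, hw⟩) fun o ho hoM hoQ =>
    h.small o ⟨ho, fun e => hoM (e ▸ hr), hoQ⟩

/-- If few robots lead to the root, then nothing remains to be done. -/
theorem hasGrouping_of_small (h : c.IsRooted r) (hk : 2 ≤ Fintype.card R)
    (hr : 2 * (reach c.next r).card ≤ Fintype.card R) : D.HasGrouping :=
  c.hasGrouping hk ∅ (by simp) (by simp) fun o ho _ hoQ => by
    by_cases hor : o = r
    · rwa [hor]
    · exact h.small o ⟨ho, hor, hoQ⟩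

theorem edge_root (h : c.IsRooted r) :
    Walk (c.network.base r) (c.network.base r) (c.network.window r) 1 := by
  have := c.network.edge r
  rw [show c.network.next r = r from h.next_root] at this
  exact this.mono subset_rfl (by linarith)

/-- The closed walk of the component of the root, with an additional link. -/
theorem exists_walk_of_link (h : c.IsRooted r) {g q : R} (hg : g ∈ reach c.next r)
    (hleaf : ∀ z, c.next z ≠ g) (hq : q ∈ reach c.next r) {S : Set E} {ℓ : ℝ}
    (hlink : Walk (c.network.base g) (c.network.base q) S ℓ) :
    ∃ S' ℓ', S ⊆ S' ∧ (∀ z ∈ reach c.next r, c.network.window z ⊆ S') ∧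
      c.network.base g ∈ S' ∧ Walk (c.network.base g) (c.network.base g) S' ℓ' ∧
      ((∃ n : ℕ, c.next^[n] g = q ∧
          ℓ' ≤ ℓ + 2 * (reach c.next r).card - 1 - n - c.start q - c.start g) ∨
        ((¬ ∃ n, c.next^[n] g = q) ∧
          ℓ' ≤ ℓ + 2 * (reach c.next r).card - 3 + c.start q - c.start g)) := by
  obtain ⟨S', ℓ', h1, h2, h3, h4, h5⟩ := c.network.exists_walk_of_link (r := r)
    (K := reach c.next r) (fun _ => mem_reach) h.next_root h.start_root hg hleaf hq hlink
    h.edge_root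
  refine ⟨S', ℓ', h1, fun z hz => ?_, (h3 g hg).1, h4, ?_⟩
  · by_cases hzr : z = r
    · rwa [hzr]
    · exact (h3 z hz).2 hzr
  · rcases h5 with ⟨n, hn, hle⟩ | ⟨hn, hle⟩
    · exact .inl ⟨n, hn, hle.trans (le_of_eq (by simp only [network]; ring))⟩
    · exact .inr ⟨hn, hle.trans (le_of_eq (by simp only [network]; ring))⟩

/-- This is the trivial link from the leaf to itself. The telescoping sum of the doubled links
leaves twice the starting time of `g` as a gain. -/
theorem exists_walk (h : c.IsRooted r) {g : R} (hg : g ∈ reach c.next r)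
    (hleaf : ∀ z, c.next z ≠ g) :
    ∃ S', (∀ z ∈ reach c.next r, c.network.window z ⊆ S') ∧
      c.network.base g ∈ S' ∧ Walk (c.network.base g) (c.network.base g) S'
        (2 * (reach c.next r).card - 1 - 2 * c.start g) := by
  obtain ⟨S', ℓ', -, h2, h3, h4, ⟨n, hn, hle⟩ | ⟨hn, -⟩⟩ :=
    h.exists_walk_of_link hg hleaf hg (Walk.refl _)
  · have := n.cast_nonneg (α := ℝ)
    exact ⟨S', h2, h3, h4.mono subset_rfl (by linarith)⟩
  · exact absurd ⟨0, rfl⟩ hn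

theorem hasGrouping_of_half_le (h : c.IsRooted r) (hk : 2 ≤ Fintype.card R) {g : R}
    (hg : g ∈ reach c.next r) (hleaf : ∀ z, c.next z ≠ g) (hs : 1 / 2 ≤ c.start g) :
    D.HasGrouping := by
  obtain ⟨S, hS, -, hw⟩ := h.exists_walk hg hleaf
  exact h.hasGrouping_of_walk hk _ h.next_mem_iff h.root_mem hS
    (hw.mono subset_rfl (by linarith))

/-- The trajectory of `r` up to time `w` is a link that already covers its window, so the loop at
the root costs nothing. With at least one link from `g` to `r` paid only once, the saving is `2`. -/
theorem hasGrouping_of_root_later (h : c.IsRooted r) (hk : 2 ≤ Fintype.card R) {g : R}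
    (hg : g ∈ reach c.next r) (hleaf : ∀ z, c.next z ≠ g) {w : ℝ} (hw : c.finish r < w)
    (hw' : w ≤ c.start g + 1) (hpos : D.pos r w = D.pos g (c.start g)) : D.HasGrouping := by
  obtain ⟨S', ℓ', h1, -, h3, h4, h5⟩ := c.network.exists_walk_of_link (r := r)
    (K := reach c.next r) (fun _ => mem_reach) h.next_root h.start_root hg hleaf h.root_mem
    (c.walk_later hw hpos) (Walk.refl _)
  refine h.hasGrouping_of_walk hk _ h.next_mem_iff h.root_mem (fun z hz => ?_)
    (h4.mono subset_rfl ?_)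
  · by_cases hzr : z = r
    · rwa [hzr]
    · exact (h3 z hz).2 hzr
  · rcases h5 with ⟨n, hn, hle⟩ | ⟨hn, -⟩
    · have hn1 : n ≠ 0 := by
        rintro rfl
        exact hleaf r (h.next_root.trans hn.symm)
      have : (1 : ℝ) ≤ n := by exact_mod_cast Nat.pos_of_ne_zero hn1
      have h0 := h.start_root
      simp only [network] at hle
      linarith
    · exact absurd (mem_reach.1 hg) hn

/-- The trajectory of `i` back from time `w` links `g` to a robot that is not above it. The two ways
to their meeting point have at least two links, and the starting times of `g` and `i` cancel against
the length of the new link. -/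
theorem hasGrouping_of_later (h : c.IsRooted r) (hk : 2 ≤ Fintype.card R) {g i : R}
    (hg : g ∈ reach c.next r) (hleaf : ∀ z, c.next z ≠ g) (hi : i ∈ reach c.next r)
    (hgi : ¬ ∃ n, c.next^[n] g = i) {w : ℝ} (hw : c.finish i < w)
    (hw' : w ≤ c.start g + 1) (hpos : D.pos i w = D.pos g (c.start g)) : D.HasGrouping := by
  obtain ⟨S', ℓ', -, h2, h3, h4, ⟨n, hn, -⟩ | ⟨-, hle⟩⟩ :=
    h.exists_walk_of_link hg hleaf hi (c.walk_later hw hpos)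
  · exact absurd ⟨n, hn⟩ hgi
  · exact h.hasGrouping_of_walk hk _ h.next_mem_iff h.root_mem h2
      (h4.mono subset_rfl (by linarith))

/-- From a robot that avoids the idle components, the parents of robots in `Q` lead to a robot that
is not in `Q`. -/
theorem exists_chain (h : c.IsRooted r) {rk : R → ℕ}
    (hrk : ∀ q ∈ c.Q, c.par q ∈ c.Q → rk (c.par q) < rk q) (q : R)
    (hq : ∀ o, c.IsIdle r o → q ∉ reach c.next o) {w : ℝ} (hw : w ≤ c.start q) :
    ∃ (N : Finset R) (z : R) (S : Set E), N ⊆ c.Q ∧ z ∉ c.Q ∧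
      (∀ o, c.IsIdle r o → z ∉ reach c.next o) ∧ (∀ n ∈ N, rk n ≤ rk q) ∧ (N = ∅ → z = q) ∧
      (∀ n ∈ N, c.network.window n ⊆ S) ∧
      Walk (D.pos q w) (c.network.base z) S (N.card + c.start z - w) := by
  induction hn : rk q using Nat.strong_induction_on generalizing q w with
  | _ n ih =>
    by_cases hqQ : q ∈ c.Q
    · have hwalk := c.walk_par q hw
      have hpar : ∀ o, c.IsIdle r o → c.par q ∉ reach c.next o := fun o ho =>
        h.par_notMem o ho q hqQ
      by_cases hpQ : c.par q ∈ c.Q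
      · obtain ⟨N, z, S, h1, h2, h3, h4, -, h6, h7⟩ :=
          ih _ (hn ▸ hrk q hqQ hpQ) (c.par q) hpar le_rfl rfl
        have hqN : q ∉ N := fun hqN => by have := h4 q hqN; have := hrk q hqQ hpQ; omega
        refine ⟨insert q N, z, _, Finset.insert_subset hqQ h1, h2, h3, fun m hm => ?_,
          fun he => absurd he (Finset.insert_ne_empty _ _), fun m hm => ?_,
          (hwalk.append h7).mono subset_rfl ?_⟩
        · rcases Finset.mem_insert.1 hm with rfl | hm
          · exact hn.le
          · have := h4 m hm; have := hrk q hqQ hpQ; omega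
        · rcases Finset.mem_insert.1 hm with rfl | hm
          · exact Set.subset_union_left
          · exact (h6 m hm).trans Set.subset_union_right
        · rw [Finset.card_insert_of_notMem hqN]; push_cast; linarith
      · refine ⟨{q}, c.par q, _, by simpa using hqQ, hpQ, hpar, by simp [hn], by simp,
          fun m hm => ?_, hwalk.mono subset_rfl (by simp)⟩
        rw [Finset.mem_singleton.1 hm]
        exact subset_rfl
    · exact ⟨∅, q, _, by simp, hqQ, hq, by simp, fun _ => rfl, by simp,
        (Walk.of_lipschitz (D.dist_pos_le q) hw).mono subset_rfl (by simp)⟩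

/-- A robot `i` passed the base point of a leaf `g` after `g`, but before its own window. -/
theorem hasGrouping_of_earlier (h : c.IsRooted r) (hk : 2 ≤ Fintype.card R) {g i : R}
    (hg : g ∈ reach c.next r) (hleaf : ∀ z, c.next z ≠ g) {w : ℝ} (hw : w < c.start i)
    (hw' : c.start g < w) (hpos : D.pos i w = D.pos g (c.start g)) : D.HasGrouping := by
  obtain ⟨rk, hrk⟩ := h.rank
  have hg0 := c.start_nonneg g
  -- Robots in idle components start at `0`, so `i`, which starts after `w > 0`, is not among them.
  -- The chain absorbs robots `N` of `Q`, each at a cost of `1` out of a budget of `2`.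
  obtain ⟨N, z, S, hNQ, hzQ, hz, -, hNz, hNS, hlink⟩ := h.exists_chain hrk i (fun o ho hi => by
    have := h.start_eq_zero o ho i hi
    linarith) hw.le
  rw [hpos] at hlink
  have hzh := c.start_le_half z
  have hN0 : (0 : ℝ) ≤ N.card := Nat.cast_nonneg _
  have hNnext : ∀ n, c.next n ∈ N ↔ n ∈ N := fun n => by
    constructor
    · intro hn
      rwa [c.eq_of_linkOf_mem _ (hNQ hn) n rfl]
    · intro hn
      rwa [c.next_of_mem (hNQ hn)]
  have hdisj : Disjoint (reach c.next r) N :=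
    Finset.disjoint_left.2 fun a ha haN => h.notMem_reach (hNQ haN) ha
  by_cases hzC : z ∈ reach c.next r
  · obtain ⟨S', ℓ', h1, h2, h3, h4, h5⟩ := h.exists_walk_of_link hg hleaf hzC hlink
    refine h.hasGrouping_of_walk hk (reach c.next r ∪ N) (fun a => ?_)
      (Finset.mem_union_left _ h.root_mem) (fun a ha => ?_) (h4.mono subset_rfl ?_)
    · rw [Finset.mem_union, Finset.mem_union, h.next_mem_iff, hNnext]
    · rcases Finset.mem_union.1 ha with ha | ha
      · exact h2 a ha
      · exact (hNS a ha).trans h1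
    · rw [Finset.card_union_of_disjoint hdisj]
      push_cast
      rcases h5 with ⟨n, hn, hle⟩ | ⟨-, hle⟩
      -- The new link returns to `g` itself only if `i = g`, which is excluded because `c.start g <
      -- w < c.start i`.
      · have hNn : (1 : ℝ) ≤ N.card + n := by
          rcases Nat.eq_zero_or_pos (N.card + n) with h0 | h0
          · exfalso
            obtain ⟨hN, rfl⟩ : N.card = 0 ∧ n = 0 := by omega
            have hzi := hNz (Finset.card_eq_zero.1 hN)
            have hgi : g = i := hn.trans hzi
            rw [hgi] at hw'
            linarith
          · exact_mod_cast h0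
        linarith
      · linarith
  · obtain ⟨S₁, hS₁, hgS₁, hw₁⟩ := h.exists_walk hg hleaf
    classical
    set B : Finset R := Finset.univ.filter fun a => Conn c.next a z with hB
    have hBmem : ∀ a, a ∈ B ↔ Conn c.next a z := fun a => by simp [hB]
    have hBnext : ∀ a, c.next a ∈ B ↔ a ∈ B := fun a => by
      rw [hBmem, hBmem]
      exact ⟨fun h => (Conn.apply a).trans h, fun h => (Conn.apply a).symm.trans h⟩
    have hBconn : ∀ a ∈ B, ∀ b ∈ B, Conn c.next a b := fun a ha b hb =>
      ((hBmem a).1 ha).trans ((hBmem b).1 hb).symm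
    have hfixed : ∀ o, c.next o = o → ¬ Conn c.next z o := fun o ho hzo => by
      have hzo := mem_reach.2 (Conn.of_fixed ho hzo)
      by_cases hoQ : o ∈ c.Q
      · rw [c.reach_of_mem hoQ, Finset.mem_singleton] at hzo
        exact hzQ (hzo ▸ hoQ)
      · by_cases hor : o = r
        · exact hzC (hor ▸ hzo)
        · exact hz o ⟨ho, hor, hoQ⟩ hzo
    obtain ⟨m, hm⟩ := exists_minimalPeriod_pos c.next z
    have hper : 2 ≤ Function.minimalPeriod c.next (c.next^[m] z) := by
      by_contra hlt
      have hone : Function.minimalPeriod c.next (c.next^[m] z) = 1 := by omega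
      exact hfixed _ (Function.minimalPeriod_eq_one_iff_isFixedPt.1 hone) (Conn.iterate z m)
    obtain ⟨S₂, -, hS₂, hw₂⟩ := c.network.exists_walk_of_cycle (K := B)
      (fun a ha => (hBnext a).2 ha) hBconn ((hBmem _).2 (Conn.iterate z m).symm) hper
    have hzS₂ := (hS₂ z ((hBmem z).2 (Conn.refl z))).2
    -- Here `z` lies in a component with a proper cycle. The two components save `1 + 2`, and the
    -- doubled connection between them loses at most `2 * c.start z ≤ 1`; this is why starting times
    -- are kept at most `1 / 2`.
    have hw₃ := (hw₁.merge hlink.double hgS₁ (Set.mem_insert _ _)).merge hw₂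
      (c := c.network.base z) (.inr (.inr (Set.mem_insert _ _))) hzS₂
    have hd2 : Disjoint (reach c.next r ∪ N) B := by
      rw [Finset.disjoint_left]
      intro a ha haB
      have haz := (hBmem a).1 haB
      rcases Finset.mem_union.1 ha with ha | ha
      · obtain ⟨n, hn⟩ := mem_reach.1 ha
        exact hfixed r h.next_root (haz.symm.trans (hn ▸ Conn.iterate a n))
      · exact hfixed a (c.next_of_mem (hNQ ha)) haz.symm
    refine h.hasGrouping_of_walk hk (reach c.next r ∪ N ∪ B) (fun a => ?_)
      (Finset.mem_union_left _ (Finset.mem_union_left _ h.root_mem)) (fun a ha => ?_)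
      (hw₃.mono subset_rfl ?_)
    · rw [Finset.mem_union, Finset.mem_union, Finset.mem_union, Finset.mem_union,
        h.next_mem_iff, hNnext, hBnext]
    · rcases Finset.mem_union.1 ha with ha | ha
      · rcases Finset.mem_union.1 ha with ha | ha
        · exact fun s hs => .inl (.inl (hS₁ a ha hs))
        · exact fun s hs => .inl (.inr (.inr (.inr (hNS a ha hs))))
      · exact fun s hs => .inr ((hS₂ a ha).1 hs)
    · rw [Finset.card_union_of_disjoint hd2, Finset.card_union_of_disjoint hdisj]
      push_cast
      linarith

end IsRooted

end Config

end Patrol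

/-! ### Changes of a configuration and termination -/

namespace Patrol

/-- A point redirected to something that leads to `r` cannot lead to `o`. So `close` and `retarget`
never enlarge an idle component. -/
theorem mem_reach_of_mem_reach_update {R : Type*} [Fintype R] [DecidableEq R] {f : R → R}
    {r o i j z : R} (hr : f r = r) (ho : f o = o) (hor : o ≠ r) (hj : j ∈ reach f r)
    (hz : z ∈ reach (Function.update f i j) o) : z ∈ reach f o := by
  obtain ⟨n, hn⟩ := mem_reach.1 hz
  clear hz
  induction n generalizing z with
  | zero => exact mem_reach.2 ⟨0, hn⟩
  | succ n ih =>
    rw [Function.iterate_succ_apply] at hn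
    have h := ih hn
    by_cases hzi : z = i
    · subst hzi
      rw [Function.update_self] at h
      obtain ⟨a, ha⟩ := mem_reach.1 h
      obtain ⟨b, hb⟩ := mem_reach.1 hj
      exfalso
      apply hor
      rw [← Function.iterate_fixed ho b, ← ha, ← Function.iterate_add_apply, add_comm,
        Function.iterate_add_apply, hb, Function.iterate_fixed hr]
    · rw [Function.update_of_ne hzi] at h
      obtain ⟨m, hm⟩ := mem_reach.1 h
      exact mem_reach.2 ⟨m + 1, hm⟩

namespace Config

variable {R P E : Type*} [MetricSpace E] [DecidableEq R] {D : PatrolData R P E}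

/-- Start the window of a leaf later. -/
def raise (c : Config D) (j : R) (t : ℝ) (h0 : c.start j ≤ t) (ht : t ≤ 1 / 2)
    (ht' : t ≤ c.finish j)
    (hcov : ∀ p, ∃ z s, (z, p, s) ∈ D.visits ∧ c.start z ≤ s ∧ s ≤ c.finish z ∧ (z = j → t ≤ s))
    (hjQ : j ∉ c.Q) (hleaf : ∀ z, c.next z ≠ j) : Config D :=
  have hle : ∀ z, c.start z ≤ Function.update c.start j t z := fun z => by
    by_cases hz : z = j
    · subst hz; simpa using h0
    · simp [hz]
  { start := Function.update c.start j t
    finish := c.finish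
    meet := c.meet
    par := c.par
    Q := c.Q
    start_nonneg := fun z => (c.start_nonneg z).trans (hle z)
    start_le_half := fun z => by
      by_cases hz : z = j
      · subst hz; simpa using ht
      · simpa [hz] using c.start_le_half z
    start_le_finish := fun z => by
      by_cases hz : z = j
      · subst hz; simpa using ht'
      · simpa [hz] using c.start_le_finish z
    meet_le := fun z => (c.meet_le z).trans (hle _)
    finish_le := c.finish_le
    pos_meet := c.pos_meet
    covers := fun p => by
      obtain ⟨z, s, h1, h2, h3, h4⟩ := hcov p
      refine ⟨z, s, h1, ?_, h3⟩
      by_cases hz : z = j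
      · subst hz; simpa using h4 rfl
      · simpa [hz] using h2
    loop := fun q hq => by
      have hqj : q ≠ j := fun h => hjQ (h ▸ hq)
      simpa [hqj] using c.loop q hq
    eq_of_linkOf_mem := c.eq_of_linkOf_mem
    linkOf_inj := fun a b hab h => by
      rw [Function.update_of_ne (hleaf a)] at h
      exact c.linkOf_inj a b hab h }

theorem linkOf_insert (c : Config D) (j : R) :
    linkOf (insert j c.Q) c.par = Function.update c.next j j := by
  ext z
  by_cases hz : z = j
  · subst hz; simp [linkOf]
  · simp [linkOf, hz]

theorem linkOf_erase (c : Config D) (i j : R) :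
    linkOf (c.Q.erase i) (Function.update c.par i j) = Function.update c.next i j := by
  ext z
  by_cases hz : z = i
  · subst hz; simp [linkOf]
  · simp [linkOf, hz]

/-- Link a leaf to itself. -/
def close (c : Config D) (j : R) (hleaf : ∀ z, c.next z ≠ j)
    (hloop : Walk (c.network.base j) (c.network.base j) (c.network.window j) 1) : Config D :=
  { start := c.start
    finish := c.finish
    meet := c.meet
    par := c.par
    Q := insert j c.Q
    start_nonneg := c.start_nonneg
    start_le_half := c.start_le_half
    start_le_finish := c.start_le_finish
    meet_le := c.meet_le
    finish_le := c.finish_le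
    pos_meet := c.pos_meet
    covers := c.covers
    loop := fun q hq => by
      rcases Finset.mem_insert.1 hq with rfl | hq
      · exact hloop
      · exact c.loop q hq
    eq_of_linkOf_mem := fun q hq z hz => by
      rw [linkOf_insert] at hz
      by_cases hzj : z = j
      · subst hzj; simpa using hz
      · rw [Function.update_of_ne hzj] at hz
        rcases Finset.mem_insert.1 hq with rfl | hq
        · exact absurd hz (hleaf z)
        · exact c.eq_of_linkOf_mem q hq z hz
    linkOf_inj := fun a b hab h => by
      rw [linkOf_insert] at hab h
      by_cases ha : a = j <;> by_cases hb : b = j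
      · rw [ha, hb]
      · subst ha
        rw [Function.update_self, Function.update_of_ne hb] at hab
        exact absurd hab.symm (hleaf b)
      · subst hb
        rw [Function.update_self, Function.update_of_ne ha] at hab
        exact absurd hab (hleaf a)
      · rw [Function.update_of_ne ha] at hab h
        rw [Function.update_of_ne hb] at hab
        exact c.linkOf_inj a b hab h }

/-- Extend the window of `i` to a visit of the base point of a leaf `j`, and link `i` to `j`. -/
def retarget (c : Config D) (i j : R) (w : ℝ) (hleaf : ∀ z, c.next z ≠ j)
    (hjQ : j ∉ c.Q) (hw : c.finish i < w) (hw' : w ≤ c.start j + 1)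
    (hpos : D.pos i w = D.pos j (c.start j)) : Config D :=
  have hle : ∀ z, c.finish z ≤ Function.update c.finish i w z := fun z => by
    by_cases hz : z = i
    · subst hz; simpa using hw.le
    · simp [hz]
  { start := c.start
    finish := Function.update c.finish i w
    meet := Function.update c.meet i (c.start j)
    par := Function.update c.par i j
    Q := c.Q.erase i
    start_nonneg := c.start_nonneg
    start_le_half := c.start_le_half
    start_le_finish := fun z => (c.start_le_finish z).trans (hle z)
    meet_le := fun z => by
      by_cases hz : z = i
      · subst hz; simp
      · simpa [hz] using c.meet_le z
    finish_le := fun z => by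
      by_cases hz : z = i
      · subst hz; simpa using hw'
      · simpa [hz] using c.finish_le z
    pos_meet := fun z => by
      by_cases hz : z = i
      · subst hz; simpa using hpos.symm
      · simpa [hz] using c.pos_meet z
    covers := fun p => by
      obtain ⟨z, t, h1, h2, h3⟩ := c.covers p
      exact ⟨z, t, h1, h2, h3.trans (hle z)⟩
    loop := fun q hq => by
      have hqi : q ≠ i := Finset.ne_of_mem_erase hq
      simpa [hqi] using c.loop q (Finset.mem_of_mem_erase hq)
    eq_of_linkOf_mem := fun q hq z hz => by
      rw [linkOf_erase] at hz
      by_cases hzi : z = i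
      · subst hzi
        rw [Function.update_self] at hz
        exact absurd (hz ▸ Finset.mem_of_mem_erase hq) hjQ
      · rw [Function.update_of_ne hzi] at hz
        exact c.eq_of_linkOf_mem q (Finset.mem_of_mem_erase hq) z hz
    linkOf_inj := fun a b hab h => by
      rw [linkOf_erase] at hab h
      by_cases ha : a = i <;> by_cases hb : b = i
      · rw [ha, hb]
      · subst ha
        rw [Function.update_self, Function.update_of_ne hb] at hab
        exact absurd hab.symm (hleaf b)
      · subst hb
        rw [Function.update_self, Function.update_of_ne ha] at hab
        exact absurd hab (hleaf a)
      · rw [Function.update_of_ne ha] at hab h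
        rw [Function.update_of_ne hb] at hab
        exact c.linkOf_inj a b hab h }

variable [Fintype R]

/-- A measure of progress: the positions of the ends of the windows among the times in `Θ`. -/
noncomputable def progress (Θ : Finset ℝ) (c : Config D) : ℕ :=
  (∑ z, ((Θ.filter (· ≤ c.start z)).card + (Θ.filter (· ≤ c.finish z)).card)) *
    (Fintype.card R + 1) + c.Q.card

theorem progress_le (Θ : Finset ℝ) (c : Config D) :
    c.progress Θ ≤ Fintype.card R * (2 * Θ.card) * (Fintype.card R + 1) + Fintype.card R := by
  refine Nat.add_le_add (Nat.mul_le_mul_right _ ?_) c.Q.card_le_univ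
  have : ∀ z ∈ (Finset.univ : Finset R),
      (Θ.filter (· ≤ c.start z)).card + (Θ.filter (· ≤ c.finish z)).card ≤ 2 * Θ.card := fun z _ => by
    have h1 := Finset.card_filter_le Θ (· ≤ c.start z)
    have h2 := Finset.card_filter_le Θ (· ≤ c.finish z)
    omega
  simpa using Finset.sum_le_card_nsmul _ _ _ this

theorem progress_lt {Θ : Finset ℝ} {c c' : Config D} (h1 : ∀ z, c.start z ≤ c'.start z)
    (h2 : ∀ z, c.finish z ≤ c'.finish z)
    (h3 : ∃ z, ∃ θ ∈ Θ, (c.start z < θ ∧ θ ≤ c'.start z) ∨ (c.finish z < θ ∧ θ ≤ c'.finish z)) :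
    c.progress Θ < c'.progress Θ := by
  have hmono : ∀ a b : ℝ, a ≤ b → (Θ.filter (· ≤ a)).card ≤ (Θ.filter (· ≤ b)).card :=
    fun a b hab => Finset.card_le_card
      (Finset.monotone_filter_right _ fun x _ hx => le_trans hx hab)
  have hstrict : ∀ a b : ℝ, ∀ θ ∈ Θ, a < θ → θ ≤ b →
      (Θ.filter (· ≤ a)).card < (Θ.filter (· ≤ b)).card := fun a b θ hθ ha hb => by
    refine Finset.card_lt_card ((Finset.ssubset_iff_of_subset (Finset.monotone_filter_right _
      fun x _ hx => le_trans hx (ha.le.trans hb))).2 ⟨θ, ?_, ?_⟩)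
    · simp [hθ, hb]
    · simp [ha]
  have hsum : ∑ z, ((Θ.filter (· ≤ c.start z)).card + (Θ.filter (· ≤ c.finish z)).card) <
      ∑ z, ((Θ.filter (· ≤ c'.start z)).card + (Θ.filter (· ≤ c'.finish z)).card) := by
    obtain ⟨z, θ, hθ, hz⟩ := h3
    refine Finset.sum_lt_sum (fun z _ => Nat.add_le_add (hmono _ _ (h1 z)) (hmono _ _ (h2 z)))
      ⟨z, Finset.mem_univ _, ?_⟩
    rcases hz with ⟨ha, hb⟩ | ⟨ha, hb⟩
    · exact Nat.add_lt_add_of_lt_of_le (hstrict _ _ θ hθ ha hb) (hmono _ _ (h2 z))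
    · exact Nat.add_lt_add_of_le_of_lt (hmono _ _ (h1 z)) (hstrict _ _ θ hθ ha hb)
  -- `Q` may lose robots, but the weight of the time counts exceeds its largest possible size.
  have hQ := c.Q.card_le_univ
  unfold progress
  nlinarith

namespace IsRooted

variable {c : Config D} {r : R}

theorem raise (h : c.IsRooted r) {j : R} {t : ℝ} (h0 : c.start j ≤ t) (ht : t ≤ 1 / 2)
    (ht' : t ≤ c.finish j)
    (hcov : ∀ p, ∃ z s, (z, p, s) ∈ D.visits ∧ c.start z ≤ s ∧ s ≤ c.finish z ∧ (z = j → t ≤ s))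
    (hjQ : j ∉ c.Q) (hleaf : ∀ z, c.next z ≠ j) (hj : j ∈ reach c.next r) :
    (c.raise j t h0 ht ht' hcov hjQ hleaf).IsRooted r where
  par_root := h.par_root
  start_root := by
    have hrj : r ≠ j := fun e => hleaf r (h.next_root.trans e)
    change Function.update c.start j t r = 0
    rw [Function.update_of_ne hrj, h.start_root]
  root_notMem := h.root_notMem
  small := h.small
  start_eq_zero := fun o ho z hz => by
    have hzj : z ≠ j := by
      rintro rfl
      obtain ⟨n, hn⟩ := mem_reach.1 hj
      obtain ⟨m, hm⟩ := mem_reach.1 hz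
      apply ho.2.1
      rw [← Function.iterate_fixed (show c.next o = o from ho.1) n]
      change c.next^[m] z = o at hm
      rw [← hm, ← Function.iterate_add_apply, add_comm, Function.iterate_add_apply, hn,
        Function.iterate_fixed h.next_root]
    change Function.update c.start j t z = 0
    rw [Function.update_of_ne hzj]
    exact h.start_eq_zero o ho z hz
  par_notMem := h.par_notMem
  rank := h.rank

theorem close (h : c.IsRooted r) {j : R} (hleaf : ∀ z, c.next z ≠ j)
    (hloop : Walk (c.network.base j) (c.network.base j) (c.network.window j) 1)
    (hj : j ∈ reach c.next r) : (c.close j hleaf hloop).IsRooted r := by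
  have hrj : r ≠ j := fun e => hleaf r (h.next_root.trans e)
  have hjQ : j ∉ c.Q := fun hjQ => h.notMem_reach hjQ hj
  have hnext : (c.close j hleaf hloop).next = Function.update c.next j j := c.linkOf_insert j
  have hidle : ∀ o, (c.close j hleaf hloop).IsIdle r o → c.IsIdle r o := by
    rintro o ⟨h1, h2, h3⟩
    have hoj : o ≠ j := fun e => h3 (e ▸ Finset.mem_insert_self _ _)
    rw [hnext, Function.update_of_ne hoj] at h1
    exact ⟨h1, h2, fun h => h3 (Finset.mem_insert_of_mem h)⟩
  have hreach : ∀ o, (c.close j hleaf hloop).IsIdle r o →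
      reach (c.close j hleaf hloop).next o ⊆ reach c.next o := fun o ho z hz => by
    rw [hnext] at hz
    exact mem_reach_of_mem_reach_update h.next_root (hidle o ho).1 ho.2.1 hj hz
  have hparj : c.par j ∈ reach c.next r := by
    rw [← c.next_of_notMem hjQ]; exact (h.next_mem_iff j).2 hj
  refine ⟨h.par_root, h.start_root, ?_, ?_, ?_, ?_, ?_⟩
  · intro hr
    rcases Finset.mem_insert.1 hr with e | hr
    · exact hrj e
    · exact h.root_notMem hr
  · intro o ho
    have := Finset.card_le_card (hreach o ho)
    have := h.small o (hidle o ho)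
    omega
  · exact fun o ho z hz => h.start_eq_zero o (hidle o ho) z (hreach o ho hz)
  · intro o ho q hq hmem
    have hmem := hreach o ho hmem
    rcases Finset.mem_insert.1 hq with rfl | hq
    · obtain ⟨n, hn⟩ := mem_reach.1 hparj
      obtain ⟨m, hm⟩ := mem_reach.1 hmem
      change c.next^[m] (c.par q) = o at hm
      apply ho.2.1
      rw [← Function.iterate_fixed (hidle o ho).1 n, ← hm, ← Function.iterate_add_apply, add_comm,
        Function.iterate_add_apply, hn, Function.iterate_fixed h.next_root]
    · exact h.par_notMem o (hidle o ho) q hq hmem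
  · obtain ⟨rk, hrk⟩ := h.rank
    -- The parent of `j` leads to `r` and is not `j`, so it lies outside the new `Q`; hence `j` may
    -- be given the lowest rank.
    refine ⟨fun z => if z = j then 0 else rk z + 1, fun q hq hpq => ?_⟩
    change c.par q ∈ insert j c.Q at hpq
    change (if c.par q = j then 0 else rk (c.par q) + 1) < if q = j then 0 else rk q + 1
    have hqj : q ≠ j := by
      rintro rfl
      rcases Finset.mem_insert.1 hpq with e | hpq
      · exact hleaf q ((c.next_of_notMem hjQ).trans e)
      · exact h.notMem_reach hpq hparj
    have hqQ : q ∈ c.Q := (Finset.mem_insert.1 hq).resolve_left hqj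
    rw [if_neg hqj]
    by_cases hpj : c.par q = j
    · simp [hpj]
    · rw [if_neg hpj]
      exact Nat.succ_lt_succ (hrk q hqQ ((Finset.mem_insert.1 hpq).resolve_left hpj))

theorem retarget (h : c.IsRooted r) {i j : R} {w : ℝ} (hleaf : ∀ z, c.next z ≠ j)
    (hjQ : j ∉ c.Q) (hw : c.finish i < w) (hw' : w ≤ c.start j + 1)
    (hpos : D.pos i w = D.pos j (c.start j)) (hj : j ∈ reach c.next r) (hij : i ≠ j)
    (hir : i ≠ r) : (c.retarget i j w hleaf hjQ hw hw' hpos).IsRooted r := by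
  set c' := c.retarget i j w hleaf hjQ hw hw' hpos with hc'
  have hnext : c'.next = Function.update c.next i j := c.linkOf_erase i j
  have hidle : ∀ o, c'.IsIdle r o → c.IsIdle r o := by
    rintro o ⟨h1, h2, h3⟩
    have hoi : o ≠ i := by
      rintro rfl
      rw [hnext, Function.update_self] at h1
      exact hij h1.symm
    rw [hnext, Function.update_of_ne hoi] at h1
    exact ⟨h1, h2, fun h => h3 (Finset.mem_erase.2 ⟨hoi, h⟩)⟩
  have hreach : ∀ o, c'.IsIdle r o → reach c'.next o ⊆ reach c.next o := fun o ho z hz => by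
    rw [hnext] at hz
    exact mem_reach_of_mem_reach_update h.next_root (hidle o ho).1 ho.2.1 hj hz
  have hpar : ∀ q, q ≠ i → c'.par q = c.par q := fun q hq => Function.update_of_ne hq _ _
  refine ⟨(hpar r hir.symm).trans h.par_root, h.start_root,
    fun hr => h.root_notMem (Finset.mem_of_mem_erase hr), ?_, ?_, ?_, ?_⟩
  · intro o ho
    have := Finset.card_le_card (hreach o ho)
    have := h.small o (hidle o ho)
    omega
  · exact fun o ho z hz => h.start_eq_zero o (hidle o ho) z (hreach o ho hz)
  · intro o ho q hq hmem
    rw [hpar q (Finset.ne_of_mem_erase hq)] at hmem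
    exact h.par_notMem o (hidle o ho) q (Finset.mem_of_mem_erase hq) (hreach o ho hmem)
  · obtain ⟨rk, hrk⟩ := h.rank
    refine ⟨rk, fun q hq hpq => ?_⟩
    rw [hpar q (Finset.ne_of_mem_erase hq)] at hpq ⊢
    exact hrk q (Finset.mem_of_mem_erase hq) (Finset.mem_of_mem_erase hpq)

/-- Without a leaf, `next` would be a permutation of this finite set, and only `r` could lead to the
fixed point `r`. -/
theorem exists_leaf (h : c.IsRooted r) (hcard : 1 < (reach c.next r).card) :
    ∃ j ∈ reach c.next r, ∀ z, c.next z ≠ j := by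
  by_contra! hno
  have hr := h.next_root
  let f : reach c.next r → reach c.next r := fun z => ⟨c.next z, (h.next_mem_iff z).2 z.2⟩
  have hsurj : Function.Surjective f := fun ⟨j, hj⟩ => by
    obtain ⟨z, hz⟩ := hno j hj
    exact ⟨⟨z, (h.next_mem_iff z).1 (hz ▸ hj)⟩, Subtype.ext hz⟩
  have hinj := Finite.injective_iff_surjective.2 hsurj
  have hf : ∀ n z, ((f^[n] z : reach c.next r) : R) = c.next^[n] z := fun n => by
    induction n with
    | zero => exact fun z => rfl
    | succ n ih => intro z; rw [Function.iterate_succ_apply, ih, Function.iterate_succ_apply]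
  obtain ⟨z, hz, hzr⟩ := Finset.exists_mem_ne hcard r
  obtain ⟨n, hn⟩ := mem_reach.1 hz
  have : f^[n] ⟨z, hz⟩ = f^[n] ⟨r, h.root_mem⟩ := Subtype.ext <| by
    rw [hf, hf, hn, Function.iterate_fixed hr]
  exact hzr (congrArg Subtype.val (hinj.iterate n this))

/-- Unless there is a grouping already, the configuration can be improved. -/
theorem exists_progress (h : c.IsRooted r) (hk : 2 ≤ Fintype.card R) {Θ : Finset ℝ}
    (hΘ : ∀ {z p t}, (z, p, t) ∈ D.visits → t ∈ Θ) (hΘ' : 1 / 2 ∈ Θ) :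
    D.HasGrouping ∨ ∃ c' : Config D, c'.IsRooted r ∧ c.progress Θ < c'.progress Θ := by
  classical
  rcases le_or_gt (2 * (reach c.next r).card) (Fintype.card R) with hsm | hbig
  · exact .inl (h.hasGrouping_of_small hk hsm)
  obtain ⟨j, hj, hleaf⟩ := h.exists_leaf (by omega)
  have hjQ : j ∉ c.Q := fun hjQ => h.notMem_reach hjQ hj
  rcases le_or_gt (1 / 2) (c.start j) with hhalf | hhalf
  · exact .inl (h.hasGrouping_of_half_le hk hj hleaf hhalf)
  have hclose : Walk (c.network.base j) (c.network.base j) (c.network.window j) 1 →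
      ∃ c' : Config D, c'.IsRooted r ∧ c.progress Θ < c'.progress Θ := fun hloop => by
    refine ⟨c.close j hleaf hloop, h.close hleaf hloop hj, ?_⟩
    change _ + c.Q.card < _ + (insert j c.Q).card
    rw [Finset.card_insert_of_notMem hjQ]
    exact Nat.lt_succ_self _
  have h0 := c.start_nonneg j
  -- The next candidate for the start of `j`. As `1 / 2` belongs to `Θ`, it does not exceed `1 / 2`.
  obtain ⟨t, htΘ, htmin⟩ := (Θ.filter (c.start j < ·)).exists_min_image id
    ⟨1 / 2, Finset.mem_filter.2 ⟨hΘ', hhalf⟩⟩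
  obtain ⟨htΘ, hjt⟩ := Finset.mem_filter.1 htΘ
  have htmin : ∀ s ∈ Θ, c.start j < s → t ≤ s := fun s hs hjs =>
    htmin s (Finset.mem_filter.2 ⟨hs, hjs⟩)
  have ht := htmin _ hΘ' hhalf
  -- A window that ends before `t ≤ 1 / 2` is so short that going back and forth through it costs at
  -- most `1`.
  rcases lt_or_ge (c.finish j) t with hst | hst
  · right
    apply hclose
    have h1 := (Walk.of_lipschitz (D.dist_pos_le j) (c.start_le_finish j)).double
    exact h1.mono (fun s hs => .inr (.inr hs)) (by linarith)
  by_cases hcov : ∀ p, ∃ z s, (z, p, s) ∈ D.visits ∧ c.start z ≤ s ∧ s ≤ c.finish z ∧ (z = j → t ≤ s)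
  · refine .inr ⟨_, h.raise hjt.le ht hst hcov hjQ hleaf hj, progress_lt (fun z => ?_)
      (fun z => le_rfl) ⟨j, t, htΘ, .inl ⟨hjt, ?_⟩⟩⟩
    · change c.start z ≤ Function.update c.start j t z
      by_cases hz : z = j
      · subst hz; simpa using hjt.le
      · simp [hz]
    · change t ≤ Function.update c.start j t j
      simp
  push Not at hcov
  obtain ⟨p, hp⟩ := hcov
  -- There are no visit times strictly between `c.start j` and `t`, so the site that blocks the
  -- raise is covered only by `j` at the start of its window.
  have honly : ∀ z s, (z, p, s) ∈ D.visits → c.start z ≤ s → s ≤ c.finish z →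
      z = j ∧ s = c.start j := fun z s hv h1 h2 => by
    obtain ⟨rfl, hlt⟩ := hp z s hv h1 h2
    refine ⟨rfl, le_antisymm ?_ h1⟩
    by_contra hgt
    exact absurd (htmin s (hΘ hv) (not_le.1 hgt)) (not_le.2 hlt)
  have hposj : D.pos j (c.start j) = D.point p := by
    obtain ⟨z, s, hv, h1, h2⟩ := c.covers p
    obtain ⟨rfl, rfl⟩ := honly z s hv h1 h2
    exact D.pos_eq hv
  obtain ⟨i, w, hv, hjw, hwj⟩ := D.forward p (c.start j) h0 hhalf.le
  have hpos : D.pos i w = D.pos j (c.start j) := (D.pos_eq hv).trans hposj.symm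
  rcases lt_or_ge w (c.start i) with hlt | hge
  · exact .inl (h.hasGrouping_of_earlier hk hj hleaf hlt hjw hpos)
  have hw : c.finish i < w := by
    by_contra hle
    have := (honly i w hv hge (not_lt.1 hle)).2
    linarith
  by_cases hij : i = j
  · subst hij
    right
    apply hclose
    exact (c.walk_later hw hpos).mono subset_rfl (by linarith)
  by_cases hir : i = r
  · subst hir
    exact .inl (h.hasGrouping_of_root_later hk hj hleaf hw hwj hpos)
  by_cases hiC : i ∈ reach c.next r ∧ ¬ ∃ n, c.next^[n] j = i
  · exact .inl (h.hasGrouping_of_later hk hj hleaf hiC.1 hiC.2 hw hwj hpos)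
  -- If `i` lies above `j`, the new link detaches a cycle from the root; if `i` is outside the
  -- component, it becomes a child of `j`.
  · refine .inr ⟨_, h.retarget hleaf hjQ hw hwj hpos hj hij hir, progress_lt (fun z => le_rfl)
      (fun z => ?_) ⟨i, w, hΘ hv, .inr ⟨hw, ?_⟩⟩⟩
    · change c.finish z ≤ Function.update c.finish i w z
      by_cases hz : z = i
      · subst hz; simpa using hw.le
      · simp [hz]
    · change w ≤ Function.update c.finish i w i
      simp

theorem hasGrouping (h : c.IsRooted r) (hk : 2 ≤ Fintype.card R) : D.HasGrouping := by
  classical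
  let Θ : Finset ℝ := insert (1 / 2) (D.finite_visits.toFinset.image fun v => v.2.2)
  have hΘ : ∀ {z p t}, (z, p, t) ∈ D.visits → t ∈ Θ := fun {z p t} hv =>
    Finset.mem_insert_of_mem (Finset.mem_image.2 ⟨(z, p, t), by simpa using hv, rfl⟩)
  set B := Fintype.card R * (2 * Θ.card) * (Fintype.card R + 1) + Fintype.card R with hB
  induction hn : B - c.progress Θ using Nat.strong_induction_on generalizing c with
  | _ n ih =>
    rcases h.exists_progress hk hΘ (Finset.mem_insert_self _ _) with hg | ⟨c', hc', hlt⟩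
    · exact hg
    · have := c'.progress_le Θ
      exact ih _ (by omega) hc' rfl

end IsRooted

end Config

end Patrol

/-! ### The initial configuration -/

namespace Patrol

namespace PatrolData

variable {R P E : Type*} [MetricSpace E] (D : PatrolData R P E)

theorem exists_first_visit (p : P) :
    ∃ z v, (z, p, v) ∈ D.visits ∧ 0 ≤ v ∧ v ≤ 1 ∧ ∀ i w, (i, p, w) ∈ D.visits → 0 ≤ w → v ≤ w := by
  have hfin : (D.visits ∩ {x | x.2.1 = p ∧ 0 ≤ x.2.2}).Finite := D.finite_visits.inter_of_left _
  obtain ⟨z, w, hv, hw, hw1⟩ := D.forward p 0 le_rfl (by norm_num)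
  obtain ⟨⟨z', p', v⟩, ⟨h1, rfl, h2⟩, hmin⟩ :=
    Set.exists_min_image _ (fun x => x.2.2) hfin ⟨(z, p, w), hv, rfl, hw.le⟩
  have hmin' : ∀ i w, (i, p', w) ∈ D.visits → 0 ≤ w → v ≤ w := fun i w hi hw =>
    hmin (i, p', w) ⟨hi, rfl, hw⟩
  exact ⟨z', v, h1, h2, (hmin' z w hv hw.le).trans (by linarith), hmin'⟩

/-- The windows up to the first visits. -/
theorem exists_config [Finite P] [DecidableEq R] :
    ∃ c : Config D, (∀ z, c.start z = 0) ∧ c.Q = ∅ := by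
  choose rob v hv h0 h1 hmin using D.exists_first_visit
  have key : ∀ z, ∃ finish meet par, 0 ≤ finish ∧ meet ≤ 0 ∧ finish ≤ meet + 1 ∧
      D.pos par meet = D.pos z finish ∧ ∀ p, rob p = z → v p ≤ finish := fun z => by
    rcases Set.eq_empty_or_nonempty {p | rob p = z} with he | hne
    · exact ⟨0, 0, z, le_rfl, le_rfl, by norm_num, rfl, fun p hp =>
        absurd hp (Set.eq_empty_iff_forall_notMem.1 he p)⟩
    · obtain ⟨p, hp, hmax⟩ := Set.exists_max_image _ v (Set.toFinite {p | rob p = z}) hne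
      rcases (h0 p).eq_or_lt with hz | hpos
      · exact ⟨0, 0, z, le_rfl, le_rfl, by norm_num, rfl, fun q hq => hz ▸ hmax q hq⟩
      · obtain ⟨i, w, hi, hw, hwv⟩ := D.backward p (v p) hpos (h1 p)
        -- A preceding visit after time `0` would contradict that `v p` is the first one. So the
        -- meeting precedes the start of the parent's window.
        have hw0 : w ≤ 0 := by
          by_contra hw0
          exact absurd (hmin p i w hi (not_le.1 hw0).le) (not_le.2 hwv)
        refine ⟨v p, w, i, h0 p, hw0, by linarith, ?_, hmax⟩
        rw [D.pos_eq hi, ← D.pos_eq (hv p)]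
        exact congrArg (fun y => D.pos y (v p)) hp
  choose finish meet par k1 k2 k3 k4 k5 using key
  exact ⟨{ start := fun _ => 0
           finish := finish
           meet := meet
           par := par
           Q := ∅
           start_nonneg := fun _ => le_rfl
           start_le_half := fun _ => by norm_num
           start_le_finish := k1
           meet_le := k2
           finish_le := k3
           pos_meet := k4
           covers := fun p => ⟨rob p, v p, hv p, h0 p, k5 _ p rfl⟩
           loop := by simp
           eq_of_linkOf_mem := by simp
           linkOf_inj := fun _ _ _ h => absurd h (lt_irrefl 0) }, fun _ => rfl, rfl⟩

theorem hasGrouping [Finite P] [Fintype R] [DecidableEq R] (hk : 2 ≤ Fintype.card R) :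
    D.HasGrouping := by
  obtain ⟨c, hstart, hQ⟩ := D.exists_config
  -- Two disjoint components cannot both contain more than half of the robots, so all self-linked
  -- components other than that of `r` are small.
  by_cases hbig : ∃ o, c.next o = o ∧ Fintype.card R < 2 * (reach c.next o).card
  · obtain ⟨r, hr, hcard⟩ := hbig
    have hnext : c.next r = c.par r := c.next_of_notMem (by simp [hQ])
    refine Config.IsRooted.hasGrouping (c := c) (r := r)
      ⟨hnext.symm.trans hr, hstart r, by simp [hQ], fun o ho => ?_, fun _ _ z _ => hstart z,
        by simp [hQ], ⟨fun _ => 0, by simp [hQ]⟩⟩ hk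
    have hdisj : Disjoint (reach c.next o) (reach c.next r) := by
      rw [Finset.disjoint_left]
      intro z hzo hzr
      obtain ⟨n, hn⟩ := mem_reach.1 hzo
      obtain ⟨m, hm⟩ := mem_reach.1 hzr
      apply ho.2.1
      rw [← Function.iterate_fixed ho.1 m, ← hn, ← Function.iterate_add_apply, Nat.add_comm,
        Function.iterate_add_apply, hm, Function.iterate_fixed hr]
    have := Finset.card_le_univ (reach c.next o ∪ reach c.next r)
    rw [Finset.card_union_of_disjoint hdisj] at this
    omega
  · push Not at hbig
    exact c.hasGrouping hk ∅ (by simp) (by simp) fun o ho _ _ => hbig o ho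

end PatrolData

end Patrol

/-! ### From a schedule to finitely many visits on continuous trajectories -/

namespace Patrol

namespace RobotSchedule

variable {P : Type*} [MetricSpace P] (f : RobotSchedule P)

theorem dist_site_le {n m : ℕ} (h : n < m) :
    dist (f.site n) (f.site m) ≤ f.arrive m - f.depart n := by
  induction m, h using Nat.le_induction with
  | base => exact f.speed_limit n
  | succ m _ ih =>
    linarith [dist_triangle (f.site n) (f.site m) (f.site (m + 1)), f.speed_limit m,
      f.arrive_le_depart m]

theorem dist_site_le_abs {n m : ℕ} {s t : ℝ} (hs : f.arrive n ≤ s) (hs' : s ≤ f.depart n)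
    (ht : f.arrive m ≤ t) (ht' : t ≤ f.depart m) : dist (f.site n) (f.site m) ≤ |s - t| := by
  rcases lt_trichotomy n m with h | rfl | h
  · linarith [f.dist_site_le h, neg_abs_le (s - t)]
  · simp
  · rw [dist_comm]
    linarith [f.dist_site_le h, le_abs_self (s - t)]

/-- The movement of the robot, in the space of functions on the sites. -/
theorem exists_path [Fintype P] : ∃ g : ℝ → P → ℝ, (∀ s t, dist (g s) (g t) ≤ |s - t|) ∧
    ∀ n t, f.arrive n ≤ t → t ≤ f.depart n → g t = fun q => dist (f.site n) q := by
  classical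
  let S : Set ℝ := {t | ∃ n, f.arrive n ≤ t ∧ t ≤ f.depart n}
  let g₀ : ℝ → P → ℝ := fun t q =>
    if h : ∃ n, f.arrive n ≤ t ∧ t ≤ f.depart n then dist (f.site h.choose) q else 0
  have hg₀ : ∀ n t, f.arrive n ≤ t → t ≤ f.depart n → g₀ t = fun q => dist (f.site n) q := by
    intro n t h1 h2
    have h : ∃ n, f.arrive n ≤ t ∧ t ≤ f.depart n := ⟨n, h1, h2⟩
    have hd := f.dist_site_le_abs h.choose_spec.1 h.choose_spec.2 h1 h2
    rw [sub_self, abs_zero, dist_le_zero] at hd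
    funext q
    simp only [g₀, dif_pos h, hd]
  have hlip : LipschitzOnWith 1 g₀ S := by
    refine LipschitzOnWith.of_dist_le_mul ?_
    rintro s ⟨n, hs, hs'⟩ t ⟨m, ht, ht'⟩
    rw [hg₀ n s hs hs', hg₀ m t ht ht', NNReal.coe_one, one_mul, dist_pi_le_iff dist_nonneg]
    intro q
    exact (dist_dist_dist_le_left _ _ _).trans (f.dist_site_le_abs hs hs' ht ht')
  -- In the sup norm on functions the stays define a 1-Lipschitz map. Its extension supplies
  -- positions while the robot travels and before it first arrives.
  obtain ⟨g, hg, hgeq⟩ := hlip.extend_pi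
  refine ⟨g, fun s t => ?_, fun n t h1 h2 => ?_⟩
  · simpa [Real.dist_eq] using hg.dist_le_mul s t
  · rw [← hgeq ⟨n, h1, h2⟩, hg₀ n t h1 h2]

theorem finite_arrive_le (T : ℝ) : {n | f.arrive n ≤ T}.Finite := by
  have h := f.tendsto_arrive.eventually_gt_atTop T
  rw [← Nat.cofinite_eq_atTop, Filter.eventually_cofinite] at h
  simpa using h

end RobotSchedule

namespace Schedule

variable {P : Type*} [MetricSpace P] {k : ℕ} (σ : Schedule P k)

theorem exists_visitsAt {L : ℝ} (hL : 0 < L) (h : σ.latency < ENNReal.ofReal L) (p : P) {a : ℝ}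
    (ha : 0 ≤ a) : ∃ t, a < t ∧ t < a + L ∧ ∃ r, (σ r).VisitsAt p t := by
  by_contra! hno
  refine absurd h (not_lt.2 ?_)
  calc ENNReal.ofReal L = ENNReal.ofReal (a + L - a) := by rw [add_sub_cancel_left]
    _ ≤ σ.siteLatency p :=
      le_iSup_of_le a <| le_iSup_of_le (a + L) <| le_iSup_of_le ha <|
        le_iSup_of_le (by linarith) <| le_iSup_of_le hno le_rfl
    _ ≤ σ.latency := le_iSup σ.siteLatency p

/-- The visits that happen at the start, at the end, or at an integer time of a stay. -/
def timedVisits (L : ℝ) : Set (Fin k × P × ℝ) :=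
  -- The shift by `2` makes room for the visits before time `0` that the backward condition needs.
  {x | -1 ≤ x.2.2 ∧ x.2.2 ≤ 2 ∧ ∃ n, (σ x.1).site n = x.2.1 ∧
    (σ x.1).arrive n ≤ L * (x.2.2 + 2) ∧ L * (x.2.2 + 2) ≤ (σ x.1).depart n ∧
    (L * (x.2.2 + 2) = (σ x.1).arrive n ∨ L * (x.2.2 + 2) = (σ x.1).depart n ∨
      ∃ i : ℤ, x.2.2 = i)}

theorem finite_timedVisits [Finite P] {L : ℝ} (hL : 0 < L) : (σ.timedVisits L).Finite := by
  let T : Set ℝ := (⋃ z, (fun n => (σ z).arrive n / L - 2) '' {n | (σ z).arrive n ≤ L * 4}) ∪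
    (⋃ z, (fun n => (σ z).depart n / L - 2) '' {n | (σ z).arrive n ≤ L * 4}) ∪
    (fun i : ℤ => (i : ℝ)) '' Set.Icc (-1) 2
  have hT : T.Finite :=
    ((Set.finite_iUnion fun z => ((σ z).finite_arrive_le _).image _).union
      (Set.finite_iUnion fun z => ((σ z).finite_arrive_le _).image _)).union
        ((Set.finite_Icc _ _).image _)
  refine (Set.finite_univ.prod (Set.finite_univ.prod hT)).subset ?_
  rintro ⟨z, p, t⟩ ⟨h1, h2, n, -, h3, h4, h5⟩
  dsimp only at h1 h2 h3 h4 h5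
  have hn : (σ z).arrive n ≤ L * 4 := h3.trans (mul_le_mul_of_nonneg_left (by linarith) hL.le)
  have ht : ∀ s, L * (t + 2) = s → s / L - 2 = t := by
    rintro s rfl
    rw [mul_div_cancel_left₀ _ hL.ne']; ring
  refine ⟨trivial, trivial, ?_⟩
  rcases h5 with h | h | ⟨i, rfl⟩
  · exact .inl (.inl (Set.mem_iUnion.2 ⟨z, n, hn, ht _ h⟩))
  · exact .inl (.inr (Set.mem_iUnion.2 ⟨z, n, hn, ht _ h⟩))
  · exact .inr ⟨i, ⟨by exact_mod_cast h1, by exact_mod_cast h2⟩, rfl⟩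

theorem exists_stay {L : ℝ} (hL : 0 < L) (h : σ.latency < ENNReal.ofReal L) (p : P) {t : ℝ}
    (ht : -1 ≤ t) : ∃ z n s A B, (σ z).site n = p ∧ (σ z).arrive n = L * (A + 2) ∧
      (σ z).depart n = L * (B + 2) ∧ A ≤ s ∧ s ≤ B ∧ t < s ∧ s < t + 1 := by
  obtain ⟨s, h1, h2, z, n, hp, h3, h4⟩ := σ.exists_visitsAt hL h p
    (a := L * (t + 2)) (mul_nonneg hL.le (by linarith))
  have key : ∀ x, x = L * (x / L - 2 + 2) := fun x => by field_simp; ring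
  refine ⟨z, n, s / L - 2, (σ z).arrive n / L - 2, (σ z).depart n / L - 2, hp, key _, key _,
    ?_, ?_, ?_, ?_⟩
  · gcongr
  · gcongr
  · rw [lt_sub_iff_add_lt, lt_div_iff₀ hL]; linarith
  · rw [sub_lt_iff_lt_add, div_lt_iff₀ hL]; linarith

/-- The schedule, in units of its latency. -/
theorem exists_patrolData [Fintype P] {L : ℝ} (hL : 0 < L) (h : σ.latency < ENNReal.ofReal L) :
    ∃ D : PatrolData (Fin k) P (P → ℝ), ∀ p q, D.point p q = dist p q / L := by
  choose g hg hgs using fun z => (σ z).exists_path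
  refine ⟨
    { pos := fun z t q => g z (L * (t + 2)) q / L
      dist_pos_le := fun z s t => ?_
      point := fun p q => dist p q / L
      visits := σ.timedVisits L
      finite_visits := σ.finite_timedVisits hL
      pos_eq := ?_
      forward := fun p t h0 h1 => ?_
      backward := fun p t h0 h1 => ?_ }, fun _ _ => rfl⟩
  · rw [dist_pi_le_iff (abs_nonneg _)]
    intro q
    have h1 := (dist_le_pi_dist _ _ q).trans (hg z (L * (s + 2)) (L * (t + 2)))
    rw [← mul_sub, abs_mul, abs_of_pos hL, add_sub_add_right_eq_sub, Real.dist_eq] at h1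
    rw [Real.dist_eq, ← sub_div, abs_div, abs_of_pos hL, div_le_iff₀ hL]
    linarith
  · rintro z p t ⟨-, -, n, hp, h1, h2, -⟩
    funext q
    dsimp only at hp h1 h2 ⊢
    rw [hgs z n _ h1 h2, hp]
  · obtain ⟨z, n, s, A, B, hp, hA, hB, hAs, hsB, hts, hst⟩ :=
      σ.exists_stay hL h p (t := t) (by linarith)
    have hmem : ∀ w, A ≤ w → w ≤ B → t < w → w ≤ t + 1 → (w = A ∨ w = B ∨ ∃ i : ℤ, w = i) →
        ∃ z w, (z, p, w) ∈ σ.timedVisits L ∧ t < w ∧ w ≤ t + 1 := fun w h1 h2 h3 h4 h5 => by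
      refine ⟨z, w, ⟨by dsimp only; linarith, by dsimp only; linarith, n, hp, ?_, ?_, ?_⟩, h3, h4⟩
      · rw [hA]; gcongr
      · rw [hB]; gcongr
      · rw [hA, hB]
        exact h5.imp (congrArg fun x => L * (x + 2)) (.imp_left (congrArg fun x => L * (x + 2)))
    rcases lt_or_ge t A with h1 | h1
    · exact hmem A le_rfl (hAs.trans hsB) h1 (by linarith) (.inl rfl)
    rcases le_or_gt B (t + 1) with h2 | h2
    · exact hmem B (hAs.trans hsB) le_rfl (by linarith) h2 (.inr (.inl rfl))
    -- The stay covers the whole interval, which contains an integer. This is why integer times are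
    -- recorded.
    have h3 := Int.lt_floor_add_one t
    have h4 := Int.floor_le t
    exact hmem (⌊t⌋ + 1) (by linarith) (by linarith) h3 (by linarith)
      (.inr (.inr ⟨⌊t⌋ + 1, by push_cast; rfl⟩))
  · obtain ⟨z, n, s, A, B, hp, hA, hB, hAs, hsB, hts, hst⟩ :=
      σ.exists_stay hL h p (t := t - 1) (by linarith)
    have hmem : ∀ w, A ≤ w → w ≤ B → t - 1 ≤ w → w < t → (w = A ∨ w = B ∨ ∃ i : ℤ, w = i) →
        ∃ z w, (z, p, w) ∈ σ.timedVisits L ∧ t - 1 ≤ w ∧ w < t := fun w h1 h2 h3 h4 h5 => by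
      refine ⟨z, w, ⟨by dsimp only; linarith, by dsimp only; linarith, n, hp, ?_, ?_, ?_⟩, h3, h4⟩
      · rw [hA]; gcongr
      · rw [hB]; gcongr
      · rw [hA, hB]
        exact h5.imp (congrArg fun x => L * (x + 2)) (.imp_left (congrArg fun x => L * (x + 2)))
    rcases lt_or_ge B t with h1 | h1
    · exact hmem B (hAs.trans hsB) le_rfl (by linarith) h1 (.inr (.inl rfl))
    rcases le_or_gt (t - 1) A with h2 | h2
    · exact hmem A le_rfl (hAs.trans hsB) h2 (by linarith) (.inl rfl)
    have h3 := Int.ceil_lt_add_one t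
    have h4 := Int.le_ceil t
    exact hmem (⌈t⌉ - 1) (by linarith) (by linarith) (by linarith) (by linarith)
      (.inr (.inr ⟨⌈t⌉ - 1, by push_cast; rfl⟩))

end Schedule

end Patrol

/-! ### Shortcutting closed walks to tours -/

namespace Patrol

variable {P : Type*}

theorem exists_isTour {S : Set P} (hS : S.Finite) (hne : S.Nonempty) :
    ∃ (m : ℕ) (c : Fin (m + 1) → P), IsTour S c := by
  have := hS.to_subtype
  have := hne.to_subtype
  obtain ⟨m, hm⟩ := Nat.exists_eq_succ_of_ne_zero (Nat.card_pos (α := S)).ne'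
  let e := (Finite.equivFinOfCardEq hm).symm
  refine ⟨m, fun i => e i, Subtype.val_injective.comp e.injective, ?_⟩
  exact (e.surjective.range_comp Subtype.val).trans Subtype.range_coe

theorem IsTour.eq_natCard {S : Set P} {m : ℕ} {c : Fin (m + 1) → P} (h : IsTour S c) :
    m + 1 = Nat.card S := by
  rw [← h.2, Nat.card_range_of_injective h.1, Nat.card_eq_fintype_card, Fintype.card_fin]

variable [MetricSpace P]

theorem tourLength_eq {m : ℕ} (c : Fin (m + 1) → P) :
    tourLength c = ∑ i : Fin m, dist (c i.castSucc) (c i.succ) + dist (c (Fin.last m)) (c 0) := by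
  rw [tourLength, Fin.sum_univ_castSucc, Fin.last_add_one]
  simp only [Fin.coeSucc_eq_succ]

theorem exists_isTSPTour [Finite P] {S : Set P} {m : ℕ} {c : Fin (m + 1) → P} (hc : IsTour S c) :
    ∃ c' : Fin (m + 1) → P, IsTSPTour S c' ∧ tourLength c' ≤ tourLength c := by
  obtain ⟨c', h1, h2⟩ := Set.exists_min_image {c : Fin (m + 1) → P | IsTour S c} tourLength
    (Set.toFinite _) ⟨c, hc⟩
  exact ⟨c', ⟨h1, h2⟩, h2 c hc⟩

/-- Shortcutting a closed walk through a set gives a tour of the set. -/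
theorem Walk.exists_isTour {E : Type*} [MetricSpace E] {S : Set P} (hS : S.Finite)
    (hne : S.Nonempty) {f : P → E} {L : ℝ} (hL : 0 ≤ L)
    (hf : ∀ p q, dist p q ≤ L * dist (f p) (f q)) {y : E} {ℓ : ℝ} (hw : Walk y y (f '' S) ℓ) :
    ∃ (m : ℕ) (c : Fin (m + 1) → P), IsTour S c ∧ tourLength c ≤ L * ℓ := by
  classical
  obtain ⟨-, t, h1, h2⟩ := hw
  let τ : P → ℝ := fun p => t (f p)
  have hτ : ∀ p ∈ S, ∀ q ∈ S, dist p q ≤ L * |τ p - τ q| := fun p hp q hq =>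
    (hf p q).trans (mul_le_mul_of_nonneg_left
      (h2 _ (Set.mem_image_of_mem f hp) _ (Set.mem_image_of_mem f hq)) hL)
  have hwrap : ∀ p ∈ S, ∀ q ∈ S, dist p q ≤ L * (ℓ - τ p + τ q) := fun p hp q hq => by
    refine (hf p q).trans (mul_le_mul_of_nonneg_left ?_ hL)
    linarith [dist_triangle (f p) y (f q), (h1 _ (Set.mem_image_of_mem f hp)).2,
      (h1 _ (Set.mem_image_of_mem f hq)).1]
  have hinj : Set.InjOn τ S := fun p hp q hq hpq => by
    have := hτ p hp q hq
    rw [hpq, sub_self, abs_zero, mul_zero] at this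
    exact dist_le_zero.1 this
  -- The sites are listed in the order of their labels, which are distinct. The steps of the tour
  -- telescope, and `hwrap` pays for the return through `y`.
  let F : Finset ℝ := hS.toFinset.image τ
  have hFne : F.Nonempty := by simpa [F] using hne
  obtain ⟨m, hm⟩ := Nat.exists_eq_succ_of_ne_zero (Finset.card_pos.2 hFne).ne'
  let e := F.orderEmbOfFin hm
  have he : ∀ i, ∃ p ∈ S, τ p = e i := fun i => by
    obtain ⟨p, hp, h⟩ := Finset.mem_image.1 (F.orderEmbOfFin_mem hm i)
    exact ⟨p, hS.mem_toFinset.1 hp, h⟩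
  choose c hcS hc using he
  refine ⟨m, c, ⟨fun i j hij => e.injective ((hc i).symm.trans ((congrArg τ hij).trans (hc j))),
    Set.Subset.antisymm (Set.range_subset_iff.2 hcS) fun p hp => ?_⟩, ?_⟩
  · have : τ p ∈ Set.range e := by
      rw [F.range_orderEmbOfFin hm]
      simpa [F] using ⟨p, hp, rfl⟩
    obtain ⟨i, hi⟩ := this
    exact ⟨i, hinj (hcS i) hp ((hc i).trans hi)⟩
  · have hstep : ∀ i : Fin m, dist (c i.castSucc) (c i.succ) ≤
        L * (τ (c i.succ) - τ (c i.castSucc)) := fun i => by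
      have := hτ _ (hcS i.castSucc) _ (hcS i.succ)
      rwa [abs_sub_comm, abs_of_nonneg] at this
      rw [hc, hc, sub_nonneg]
      exact e.monotone i.castSucc_lt_succ.le
    have hsum : ∑ i : Fin m, (τ (c i.succ) - τ (c i.castSucc)) = τ (c (Fin.last m)) - τ (c 0) := by
      have h1 := Fin.sum_univ_succ fun i => τ (c i)
      have h2 := Fin.sum_univ_castSucc fun i => τ (c i)
      rw [Finset.sum_sub_distrib]
      linarith
    calc tourLength c = ∑ i : Fin m, dist (c i.castSucc) (c i.succ) + dist (c (Fin.last m)) (c 0) :=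
        tourLength_eq c
      _ ≤ ∑ i : Fin m, L * (τ (c i.succ) - τ (c i.castSucc)) +
          L * (ℓ - τ (c (Fin.last m)) + τ (c 0)) :=
        add_le_add (Finset.sum_le_sum fun i _ => hstep i) (hwrap _ (hcS _) _ (hcS _))
      _ = L * ℓ := by
        rw [← Finset.mul_sum, hsum]; ring

end Patrol

/-! ### Cyclic schedules and their latency -/

namespace Patrol

section Tour

variable {P : Type*} [MetricSpace P] {m : ℕ} (c : Fin (m + 1) → P)

/-- The distance travelled along the closed tour `c` after `n` steps. -/
noncomputable def tourDist (n : ℕ) : ℝ :=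
  ∑ j ∈ Finset.range n, dist (c (Fin.ofNat (m + 1) j)) (c (Fin.ofNat (m + 1) j + 1))

theorem tourDist_succ (n : ℕ) : tourDist c (n + 1) =
    tourDist c n + dist (c (Fin.ofNat (m + 1) n)) (c (Fin.ofNat (m + 1) n + 1)) :=
  Finset.sum_range_succ _ _

theorem tourDist_mono : Monotone (tourDist c) :=
  monotone_nat_of_le_succ fun n => by
    rw [tourDist_succ]
    exact le_add_of_nonneg_right dist_nonneg

theorem tourDist_val (i : Fin (m + 1)) : tourDist c i = arcLength c i := by
  rw [tourDist, arcLength, ← Nat.Iio_eq_range, ← Fin.map_valEmbedding_Iio, Finset.sum_map]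
  simp

theorem tourDist_length : tourDist c (m + 1) = tourLength c := by
  rw [tourDist, tourLength, Finset.sum_range]
  simp

theorem tourDist_add_length (n : ℕ) : tourDist c (n + (m + 1)) = tourDist c n + tourLength c := by
  induction n with
  | zero => rw [Nat.zero_add, tourDist_length]; simp [tourDist]
  | succ n ih =>
    have : Fin.ofNat (m + 1) (n + (m + 1)) = Fin.ofNat (m + 1) n := by
      ext; simp [Fin.ofNat]
    rw [Nat.add_right_comm, tourDist_succ, ih, tourDist_succ, this]
    ring

theorem tourDist_add_mul (i : Fin (m + 1)) (q : ℕ) :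
    tourDist c (i + q * (m + 1)) = arcLength c i + q * tourLength c := by
  induction q with
  | zero => simp [tourDist_val]
  | succ q ih =>
    rw [Nat.succ_mul, ← Nat.add_assoc, tourDist_add_length, ih]
    push_cast; ring

theorem arcLength_le (i : Fin (m + 1)) : arcLength c i ≤ tourLength c := by
  rw [← tourDist_val, ← tourDist_length]
  exact tourDist_mono c i.is_lt.le

theorem tourLength_nonneg : 0 ≤ tourLength c := Finset.sum_nonneg fun _ _ => dist_nonneg

variable {c}

theorem eq_of_tourLength_eq_zero (h : tourLength c = 0) (i : Fin (m + 1)) : c i = c 0 := by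
  have hstep : ∀ i, c (i + 1) = c i := fun i =>
    (dist_eq_zero.1 ((Finset.sum_eq_zero_iff_of_nonneg fun _ _ => dist_nonneg).1 h i
      (Finset.mem_univ i))).symm
  induction i using Fin.induction with
  | zero => rfl
  | succ i ih => rw [← Fin.coeSucc_eq_succ, hstep, ih]

/-- A robot that moves at unit speed along a tour. -/
theorem exists_tourSchedule (c : Fin (m + 1) → P) {x : ℝ} (hx : 0 ≤ x) : ∃ f : RobotSchedule P,
    ∀ t, 0 ≤ t → ∀ p, f.VisitsAt p t ↔ TourAt c (t + x) p := by
  classical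
  rcases (tourLength_nonneg c).eq_or_lt with h0 | hpos
  · refine ⟨
      { site := fun _ => c 0
        arrive := fun n => n
        depart := fun n => n + 1
        arrive_nonneg := by simp
        arrive_le_depart := fun n => by linarith
        speed_limit := fun n => by simp
        tendsto_arrive := tendsto_natCast_atTop_atTop }, fun t ht p => ⟨?_, fun h => ?_⟩⟩
    · rintro ⟨n, rfl, -, -⟩
      exact .inl ⟨h0.symm, 0, rfl⟩
    · have hp : ∃ i, c i = p := by
        rcases h with ⟨-, h⟩ | ⟨i, -, h, -⟩
        exacts [h, ⟨i, h⟩]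
      obtain ⟨i, rfl⟩ := hp
      exact ⟨⌊t⌋₊, (eq_of_tourLength_eq_zero h0.symm i).symm, Nat.floor_le ht,
        (Nat.lt_floor_add_one t).le⟩
  · have hmul : ∀ q : ℕ, tourDist c (q * (m + 1)) = q * tourLength c := fun q => by
      have h0 : arcLength c 0 = 0 := by rw [← tourDist_val]; simp [tourDist]
      simpa [h0] using tourDist_add_mul c 0 q
    have hunb : ∀ b, ∃ n, b ≤ tourDist c n := fun b => by
      obtain ⟨q, hq⟩ := exists_nat_ge (b / tourLength c)
      exact ⟨q * (m + 1), by rw [hmul]; exact (div_le_iff₀ hpos).1 hq⟩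
    -- An additional lap: `arcLength_le` is not strict, so `TourAt` may hold with `z = -1`.
    set y := x + tourLength c with hy
    let n₀ := Nat.find (hunb y)
    have htend : Filter.Tendsto (fun n => tourDist c (n + n₀) - y) Filter.atTop Filter.atTop :=
      Filter.tendsto_atTop_add_const_right _ _ ((Filter.tendsto_add_atTop_iff_nat n₀).2
        (Filter.tendsto_atTop_atTop_of_monotone (tourDist_mono c) hunb))
    refine ⟨
      { site := fun n => c (Fin.ofNat (m + 1) (n + n₀))
        arrive := fun n => tourDist c (n + n₀) - y
        depart := fun n => tourDist c (n + n₀) - y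
        arrive_nonneg := by
          rw [Nat.zero_add, sub_nonneg]
          exact Nat.find_spec (hunb y)
        arrive_le_depart := fun n => le_rfl
        speed_limit := fun n => by
          have : Fin.ofNat (m + 1) (n + 1 + n₀) = Fin.ofNat (m + 1) (n + n₀) + 1 := by
            ext
            simp [Fin.ofNat, Fin.val_add, Nat.add_right_comm]
          rw [this, Nat.add_right_comm n 1, tourDist_succ]
          linarith
        tendsto_arrive := htend }, fun t ht p => ⟨?_, ?_⟩⟩
    · rintro ⟨n, rfl, h1, h2⟩
      have h3 := tourDist_add_mul c (Fin.ofNat (m + 1) (n + n₀)) ((n + n₀) / (m + 1))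
      rw [show (Fin.ofNat (m + 1) (n + n₀) : ℕ) = (n + n₀) % (m + 1) from rfl,
        Nat.mod_add_div'] at h3
      refine .inr ⟨_, ((n + n₀) / (m + 1) : ℕ) - 1, rfl, ?_⟩
      generalize (n + n₀) / (m + 1) = q at h3 ⊢
      dsimp only at h1 h2
      push_cast
      linarith
    · rintro (⟨h, -⟩ | ⟨i, z, rfl, h⟩)
      · exact absurd h hpos.ne'
      · have hz : 0 ≤ z + 1 := by
          have h1 : (0 : ℝ) ≤ (z + 1) * tourLength c := by
            have := arcLength_le c i
            linarith
          exact_mod_cast nonneg_of_mul_nonneg_left h1 hpos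
        obtain ⟨q, hq⟩ := Int.eq_ofNat_of_zero_le hz
        have hq' : (z : ℝ) + 1 = q := by exact_mod_cast hq
        have hd : tourDist c (i + q * (m + 1)) = t + y := by
          rw [tourDist_add_mul, ← hq', hy]
          linarith
        obtain ⟨n, hn⟩ := Nat.exists_eq_add_of_le'
          (Nat.find_min' (hunb y) (m := i + q * (m + 1)) (by linarith))
        have hn' : i + q * (m + 1) = n + n₀ := hn
        refine ⟨n, ?_, ?_, ?_⟩
        · change c (Fin.ofNat (m + 1) (n + n₀)) = c i
          rw [← hn']
          congr 1
          ext
          simp [Fin.ofNat, Nat.mod_eq_of_lt i.is_lt]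
        · change tourDist c (n + n₀) - y ≤ t
          rw [← hn']; linarith
        · change t ≤ tourDist c (n + n₀) - y
          rw [← hn']; linarith

/-- Robots that are evenly spaced along a tour visit each site of the tour regularly. -/
theorem exists_tourAt (i : Fin (m + 1)) {n : ℕ} (hn : 0 < n) {a b : ℝ} (hab : a < b)
    (h : tourLength c / n < b - a) :
    ∃ (j : Fin n) (t : ℝ), a < t ∧ t < b ∧ TourAt c (t + j * (tourLength c / n)) (c i) := by
  rcases (tourLength_nonneg c).eq_or_lt with h0 | hpos
  · exact ⟨⟨0, hn⟩, (a + b) / 2, by linarith, by linarith, .inl ⟨h0.symm, i, rfl⟩⟩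
  have hn' : (0 : ℝ) < n := by exact_mod_cast hn
  set δ := tourLength c / n with hδ
  have hδ0 : 0 < δ := div_pos hpos hn'
  have hlen : tourLength c = n * δ := by rw [hδ]; field_simp
  -- The first time after `a` at which a robot is due at `c i` is `arcLength c i + u * δ`; the robot
  -- is the one whose index is `-u` modulo `n`.
  set u := ⌊(a - arcLength c i) / δ⌋ + 1 with hu
  have h1 : a - arcLength c i < u * δ := by
    rw [← div_lt_iff₀ hδ0, hu]
    push_cast
    exact Int.lt_floor_add_one _
  have h2 : u * δ ≤ a - arcLength c i + δ := by
    have := (le_div_iff₀ hδ0).1 (Int.floor_le ((a - arcLength c i) / δ))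
    rw [hu]
    push_cast
    linarith
  have hnz : (0 : ℤ) < n := by exact_mod_cast hn
  obtain ⟨j, hj⟩ := Int.eq_ofNat_of_zero_le (Int.emod_nonneg (-u) hnz.ne')
  have hjn : j < n := by
    have := Int.emod_lt_of_pos (-u) hnz
    rw [hj] at this
    exact_mod_cast this
  refine ⟨⟨j, hjn⟩, arcLength c i + u * δ, by linarith, by linarith,
    .inr ⟨i, -((-u) / n), rfl, ?_⟩⟩
  have h3 : (j : ℤ) + n * (-u / n) = -u := by rw [← hj]; exact Int.emod_add_mul_ediv _ _
  have h4 : (j : ℝ) + n * ((-u / n : ℤ) : ℝ) = -u := by exact_mod_cast h3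
  rw [hlen]
  push_cast
  linear_combination δ * h4

end Tour

variable {P : Type*} [MetricSpace P] {k : ℕ}

theorem CyclicPlan.exists_schedule (C : CyclicPlan P k) {M : ℝ}
    (hM : ∀ i, tourLength (C.tour i) ≤ M * C.numRobots i) :
    ∃ σ : Schedule P k, σ.IsCyclic ∧ σ.latency ≤ ENNReal.ofReal M := by
  choose F hF using fun x : Σ i, Fin (C.numRobots i) => exists_tourSchedule (C.tour x.1)
    (x := x.2 * (tourLength (C.tour x.1) / C.numRobots x.1))
    (mul_nonneg (Nat.cast_nonneg _) (div_nonneg (tourLength_nonneg _) (Nat.cast_nonneg _)))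
  have hσ : ∀ x t, 0 ≤ t → ∀ p, (F (C.robot.symm (C.robot x))).VisitsAt p t ↔
      TourAt (C.tour x.1) (t + x.2 * (tourLength (C.tour x.1) / C.numRobots x.1)) p := by
    intro x
    rw [Equiv.symm_apply_apply]
    exact hF x
  refine ⟨fun z => F (C.robot.symm z), ⟨C, fun _ => 0, fun i j t ht p => ?_⟩, ?_⟩
  · rw [hσ ⟨i, j⟩ t ht p, zero_add]
  · refine iSup_le fun p => iSup_le fun a => iSup_le fun b => iSup_le fun ha => iSup_le fun hab =>
      iSup_le fun hno => ENNReal.ofReal_le_ofReal ?_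
    obtain ⟨i, hi⟩ := C.group_cover p
    rw [← (C.isTSPTour i).1.2] at hi
    obtain ⟨i', rfl⟩ := hi
    by_contra hlt
    have hn : (0 : ℝ) < C.numRobots i := by exact_mod_cast C.numRobots_pos i
    obtain ⟨j, t, h1, h2, h3⟩ := exists_tourAt i' (C.numRobots_pos i) hab
      (((div_le_iff₀ hn).2 (hM i)).trans_lt (not_le.1 hlt))
    exact hno t h1 h2 _ ((hσ ⟨i, j⟩ t (ha.trans h1.le) _).2 h3)

/-- The cyclic solution for a given distribution of the sites and the robots over `N` groups. -/
theorem exists_isCyclic [Finite P] {N : ℕ} (κ : P → Fin N) {ρ : Fin k → Fin N}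
    (hρ : Function.Surjective ρ) {M : ℝ} (h : ∀ i, ∃ (m : ℕ) (c : Fin (m + 1) → P),
      IsTour {p | κ p = i} c ∧ tourLength c ≤ M * Fintype.card {z // ρ z = i}) :
    ∃ σ : Schedule P k, σ.IsCyclic ∧ σ.latency ≤ ENNReal.ofReal M := by
  choose m c₀ hc₀ hlen₀ using h
  choose c hc hlen using fun i => exists_isTSPTour (hc₀ i)
  let C : CyclicPlan P k :=
    { numGroups := N
      group := fun i => {p | κ p = i}
      group_nonempty := fun i => (hc i).1.2 ▸ Set.range_nonempty _
      group_disjoint := fun i j hij =>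
        Set.disjoint_left.2 fun p hi hj => hij (hi.symm.trans hj)
      group_cover := fun p => ⟨κ p, rfl⟩
      lastIndex := m
      tour := c
      isTSPTour := hc
      numRobots := fun i => Fintype.card {z // ρ z = i}
      numRobots_pos := fun i => Fintype.card_pos_iff.2 ((hρ i).elim fun z hz => ⟨⟨z, hz⟩⟩)
      robot := (Equiv.sigmaCongrRight fun i => (Fintype.equivFin {z // ρ z = i}).symm).trans
        (Equiv.sigmaFiberEquiv ρ) }
  exact C.exists_schedule fun i => (hlen i).trans (hlen₀ i)

/-- The groups without sites are dissolved. -/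
theorem exists_isCyclic_of_grouping [Finite P] [Nonempty P] (group : Fin k → Fin k)
    (robotOf : P → Fin k) {M : ℝ} (hM : 0 ≤ M)
    (h : ∀ p, ∃ (m : ℕ) (c : Fin (m + 1) → P),
      IsTour {q | group (robotOf q) = group (robotOf p)} c ∧
        tourLength c ≤ M * (Finset.univ.filter fun z => group z = group (robotOf p)).card) :
    ∃ σ : Schedule P k, σ.IsCyclic ∧ σ.latency ≤ ENNReal.ofReal M := by
  classical
  let G : Set (Fin k) := Set.range fun p => group (robotOf p)
  let e : G ≃ Fin (Nat.card G) := Finite.equivFin G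
  obtain ⟨p₀⟩ := ‹Nonempty P›
  let κ : P → G := fun p => ⟨group (robotOf p), p, rfl⟩
  -- Robots of groups without sites join the group of an arbitrary site; more robots there only
  -- relax the bound.
  let ρ : Fin k → G := fun z => if hz : group z ∈ G then ⟨group z, hz⟩ else κ p₀
  have hρ : ∀ z p, group z = group (robotOf p) → ρ z = κ p := fun z p hz => by
    have hz' : group z ∈ G := ⟨p, hz.symm⟩
    simp only [ρ, dif_pos hz', κ, hz]
  refine exists_isCyclic (fun p => e (κ p)) (ρ := fun z => e (ρ z)) ?_ (M := M) fun i => ?_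
  · refine e.surjective.comp ?_
    rintro ⟨_, p, rfl⟩
    exact ⟨robotOf p, hρ _ p rfl⟩
  · obtain ⟨⟨_, p, rfl⟩, rfl⟩ := e.surjective i
    obtain ⟨m, c, hc, hlen⟩ := h p
    refine ⟨m, c, ?_, hlen.trans (mul_le_mul_of_nonneg_left ?_ hM)⟩
    · convert hc using 1
      ext q
      exact e.injective.eq_iff.trans Subtype.mk_eq_mk
    · rw [Fintype.card_subtype]
      refine Nat.cast_le.2 (Finset.card_le_card fun z hz => ?_)
      rw [Finset.mem_filter] at hz ⊢
      exact ⟨Finset.mem_univ z, congrArg e (hρ z p hz.2)⟩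

end Patrol

/-! ### Passing to the optimal latency -/

namespace Patrol

variable {P : Type*} [MetricSpace P] [Finite P] {k : ℕ}

/-- A schedule of latency less than `L` gives a grouping with tours of a length that is at most
`(2 - 2 / k) L` times the number of robots. -/
theorem Schedule.exists_grouping (hk : 2 ≤ k) (σ : Schedule P k) {L : ℝ} (hL : 0 < L)
    (h : σ.latency < ENNReal.ofReal L) :
    ∃ g : (Fin k → Fin k) × (P → Fin k), ∀ p, ∃ (m : ℕ) (c : Fin (m + 1) → P),
      IsTour {q | g.1 (g.2 q) = g.1 (g.2 p)} c ∧ tourLength c ≤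
        L * ((2 - 2 / k) * (Finset.univ.filter fun z => g.1 z = g.1 (g.2 p)).card) := by
  have := Fintype.ofFinite P
  obtain ⟨D, hD⟩ := σ.exists_patrolData hL h
  obtain ⟨group, robotOf, hg⟩ := D.hasGrouping (by simpa using hk)
  refine ⟨(group, robotOf), fun p => ?_⟩
  obtain ⟨y, hy⟩ := hg (robotOf p)
  rw [Fintype.card_fin] at hy
  have hne : {q | group (robotOf q) = group (robotOf p)}.Nonempty := ⟨p, rfl⟩
  refine hy.exists_isTour (Set.toFinite _) hne hL.le fun a b => ?_
  -- The coordinate at `b` already recovers the distance between the two sites.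
  have h1 := dist_le_pi_dist (D.point a) (D.point b) b
  rw [hD, hD, dist_self, zero_div, Real.dist_eq, sub_zero,
    abs_of_nonneg (div_nonneg dist_nonneg hL.le), div_le_iff₀ hL] at h1
  linarith

/-- A single grouping works for all the latencies above the optimal one. -/
theorem exists_grouping_of_optimalLatency (hk : 2 ≤ k) {L : ℝ} (hL : 0 ≤ L)
    (hopt : optimalLatency P k = ENNReal.ofReal L) :
    ∃ g : (Fin k → Fin k) × (P → Fin k), ∀ p, ∃ (m : ℕ) (c : Fin (m + 1) → P),
      IsTour {q | g.1 (g.2 q) = g.1 (g.2 p)} c ∧ tourLength c ≤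
        (2 - 2 / k) * L * (Finset.univ.filter fun z => g.1 z = g.1 (g.2 p)).card := by
  -- The infimum need not be attained. If every grouping failed at `L`, then by finiteness and
  -- continuity all would still fail at some `x > L`, where a schedule of latency below `x` provides
  -- one that works.
  by_contra! hno
  choose p hp using hno
  have htour : ∀ g : (Fin k → Fin k) × (P → Fin k), ∃ (m : ℕ) (c : Fin (m + 1) → P),
      IsTSPTour {q | g.1 (g.2 q) = g.1 (g.2 (p g))} c := fun g => by
    have hne : {q | g.1 (g.2 q) = g.1 (g.2 (p g))}.Nonempty := ⟨p g, rfl⟩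
    obtain ⟨m, c, hc⟩ := exists_isTour (Set.toFinite _) hne
    obtain ⟨c', hc', -⟩ := exists_isTSPTour hc
    exact ⟨m, c', hc'⟩
  choose m c hc using htour
  have hev : ∀ᶠ x in nhds L, ∀ g, x * ((2 - 2 / k) *
      (Finset.univ.filter fun z => g.1 z = g.1 (g.2 (p g))).card) < tourLength (c g) := by
    refine Filter.eventually_all.2 fun g => (continuous_mul_const _).continuousAt.eventually_lt
      continuousAt_const ?_
    linarith [hp g (m g) (c g) (hc g).1]
  obtain ⟨x, hx, hLx⟩ := ((hev.filter_mono nhdsWithin_le_nhds).and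
    (self_mem_nhdsWithin (s := Set.Ioi L))).exists
  have hx0 : 0 < x := hL.trans_lt hLx
  obtain ⟨σ, hσ⟩ := iInf_lt_iff.1 (hopt.trans_lt ((ENNReal.ofReal_lt_ofReal_iff hx0).2 hLx))
  obtain ⟨g, hg⟩ := σ.exists_grouping hk hx0 hσ
  obtain ⟨m', c', hc', hlen⟩ := hg (p g)
  obtain rfl : m' = m g := Nat.succ_injective (hc'.eq_natCard.trans (hc g).1.eq_natCard.symm)
  exact absurd ((hc g).2 c' hc') (not_le.2 (hlen.trans_lt (hx g)))

end Patrol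

theorem mainTheorem1 {P : Type*} [MetricSpace P] [Finite P] [Nonempty P] (k : ℕ) (hk : 2 ≤ k) :
    ∃ σ : Patrol.Schedule P k, σ.IsCyclic ∧
      σ.latency ≤ ENNReal.ofReal (2 * (1 - 1 / (k : ℝ))) * Patrol.optimalLatency P k := by
  have hk0 : (2 : ℝ) ≤ k := by exact_mod_cast hk
  have hfac : 0 < 2 * (1 - 1 / (k : ℝ)) := by
    have : 1 / (k : ℝ) < 1 := by rw [div_lt_one (by linarith)]; linarith
    linarith
  by_cases htop : Patrol.optimalLatency P k = ⊤
  · rw [htop, ENNReal.mul_top (ENNReal.ofReal_pos.2 hfac).ne']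
    obtain ⟨m, c, hc⟩ := Patrol.exists_isTour (Set.toFinite (Set.univ : Set P)) Set.univ_nonempty
    have : NeZero k := ⟨by omega⟩
    obtain ⟨σ, hσ, -⟩ := Patrol.exists_isCyclic_of_grouping (P := P) (k := k) (fun _ => 0)
      (fun _ => 0) (Patrol.tourLength_nonneg c) fun p => ⟨m, c, by simpa using hc, by
        have := Patrol.tourLength_nonneg c
        simp only [Finset.filter_true, Finset.card_univ, Fintype.card_fin]
        nlinarith⟩
    exact ⟨σ, hσ, le_top⟩
  · have hopt := (ENNReal.ofReal_toReal htop).symm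
    obtain ⟨g, hg⟩ := Patrol.exists_grouping_of_optimalLatency hk ENNReal.toReal_nonneg hopt
    have hfac' : 2 * (1 - 1 / (k : ℝ)) = 2 - 2 / k := by ring
    rw [hopt, ← ENNReal.ofReal_mul hfac.le, hfac']
    exact Patrol.exists_isCyclic_of_grouping g.1 g.2
      (mul_nonneg (hfac' ▸ hfac.le) ENNReal.toReal_nonneg) hg
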